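/- Let $\mathcal S$ be the family of real biquadratic fields $K=\mathbb Q(\sqrt a,\sqrt b)$ with $a,b$ odd squarefree positive integers and $[K:\mathbb Q]=4$, where each field is counted once (equivalently, $\mathcal S$ is a set of subfields of $\mathbb R$). Let $\Delta_K$ be the discriminant of $K$, and for $X>0$ put $\mathcal S(X)=\#\{K\in\mathcal S : |\Delta_K|\le X\}$, which is finite. Then, as $X\to\infty$, $$\mathcal S(X)=\frac{7}{1920}\,\sqrt X\,(\log X)^2\prod_{p}\Bigl(1-\frac1p\Bigr)^3\Bigl(1+\frac3p\Bigr)+O\bigl(\sqrt X\log X\bigr),$$ where the product runs over all primes $p$ (including $p=2$) and converges absolutely. -/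

import Mathlib

open Filter Asymptotics

/-- The real biquadratic fields `ℚ(√a, √b)` with `a, b` odd, squarefree (and positive), realised as
subfields of `ℝ`. Such a field is Galois over `ℚ`, so each isomorphism class has exactly one
representative in `ℝ`. The degree condition says that the field is really biquadratic. -/
def oddRealBiquadraticFields : Set (IntermediateField ℚ ℝ) :=
  {K | Module.finrank ℚ K = 4 ∧
    ∃ a b : ℕ, Odd a ∧ Odd b ∧ Squarefree a ∧ Squarefree b ∧
      K = IntermediateField.adjoin ℚ {Real.sqrt (a : ℝ), Real.sqrt (b : ℝ)}}

/-- The fields of the family whose absolute discriminant is at most `X`. -/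
def oddRealBiquadraticFieldsUpTo (X : ℝ) : Set (IntermediateField ℚ ℝ) :=
  {K | K ∈ oddRealBiquadraticFields ∧
    ∃ _ : NumberField K, ((|NumberField.discr K| : ℤ) : ℝ) ≤ X}

/-- The local factor `(1 - 1/p)^3 (1 + 3/p)`. -/
noncomputable def biquadraticEulerFactor (p : Nat.Primes) : ℝ :=
  (1 - 1 / (p : ℝ)) ^ 3 * (1 + 3 / (p : ℝ))

/-!
Writing `a = g v`, `b = g w` with `g = gcd a b` shows that a field of the family is
`ℚ(√(uv), √(uw), √(vw))` for exactly one triple `u < v < w` with `u v w` odd and squarefree. An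
explicit integral basis gives its discriminant: `(u v w)²` if `u`, `v`, `w` agree modulo `4`, and
`16 (u v w)²` otherwise. So, up to `O(√X)` triples with a repeated entry, six times the number of
fields is the number of ordered triples with `u v w ≤ √X` or `u v w ≤ √X / 4`, depending on the
congruence. That congruence is detected by
`(1 + χ(u) χ(v) + χ(u) χ(w) + χ(v) χ(w)) / 4`, where `χ` is the quadratic character modulo `4`.

The number of factorisations of an odd squarefree `n` into three factors is the Dirichlet
convolution of `ζ * ζ * ζ` with a correction whose Dirichlet series converges absolutely at `3 / 4`.
The summatory function of `ζ * ζ * ζ` is `y (log y)² / 2 + O(y log y)`, whereas `χ * χ * ζ` has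
summatory function `O(y log y)` because the partial sums of `χ` are bounded. The correction series
at `1` is `2 / 5` of the Euler product, the difference coming from the prime `2`, and
`7 / 1920 = (1 / 6) * (1 / 4 + 3 / 4 * (1 / 4)) * (1 / 2) * (1 / 2) ^ 2 * (2 / 5)`, where
`(1 / 2) ^ 2` comes from `(log √X)²`.
-/

/-! ### Discriminants of biquadratic fields -/

section IntegralityLemmas

variable {K : Type*} [Field K] [CharZero K]

theorem exists_int_of_isIntegral_ratCast {q : ℚ} (h : IsIntegral ℤ (q : K)) : ∃ n : ℤ, q = n := by
  have hq : IsIntegral ℤ q :=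
    (isIntegral_algebraMap_iff (algebraMap ℚ K).injective).mp (by simpa using h)
  obtain ⟨n, hn⟩ := IsIntegrallyClosed.isIntegral_iff.mp hq
  exact ⟨n, by simpa using hn.symm⟩

theorem exists_int_of_isIntegral_of_mul_eq_intCast {x : K} (hx : IsIntegral ℤ x) {m z : ℤ}
    (hm : m ≠ 0) (h : m * x = z) : ∃ n : ℤ, x = n := by
  have hmK : (m : K) ≠ 0 := Int.cast_ne_zero.mpr hm
  have hxq : x = ((z / m : ℚ) : K) := by
    push_cast
    rw [eq_div_iff hmK, ← h, mul_comm]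
  obtain ⟨n, hn⟩ := exists_int_of_isIntegral_ratCast (hxq ▸ hx)
  exact ⟨n, by rw [hxq, hn, Rat.cast_intCast]⟩

theorem isIntegral_of_sq_eq_add {A : Type*} [CommRing A] {x : A} (m n : ℤ)
    (h : x ^ 2 = m * x + n) : IsIntegral ℤ x := by
  refine ⟨Polynomial.X ^ 2 + (-Polynomial.C m * Polynomial.X - Polynomial.C n),
    Polynomial.monic_X_pow_add ?_, ?_⟩
  · rw [← Polynomial.C_neg, sub_eq_add_neg, ← Polynomial.C_neg]
    exact Polynomial.degree_linear_le.trans_lt (by norm_num)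
  · rw [← Polynomial.aeval_def]
    simp only [map_add, map_sub, map_mul, map_neg, map_pow, Polynomial.aeval_X, eq_intCast,
      map_intCast]
    linear_combination h

theorem exists_int_of_squarefree_mul_sq_eq {d : ℕ} (hd : Squarefree d) {q : ℚ} {m : ℤ}
    (h : (d : ℚ) * q ^ 2 = m) : ∃ n : ℤ, q = n := by
  have hnum : (d : ℤ) * q.num ^ 2 = m * (q.den : ℤ) ^ 2 := by
    have hden : (q.den : ℚ) ≠ 0 := Nat.cast_ne_zero.mpr q.den_nz
    rw [← Rat.num_div_den q] at h
    field_simp at h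
    rw [mul_comm m]
    exact_mod_cast h
  have hcoprime : IsCoprime ((q.den : ℤ) ^ 2) (q.num ^ 2) :=
    (Int.isCoprime_iff_nat_coprime.mpr (by simpa using q.reduced.symm)).pow
  have hdvd : q.den * q.den ∣ d := by
    rw [← pow_two]
    exact_mod_cast hcoprime.dvd_of_dvd_mul_right (Dvd.intro_left _ hnum.symm)
  exact ⟨q.num, ((Rat.den_eq_one_iff q).mp (Nat.isUnit_iff.mp (hd _ hdvd))).symm⟩

theorem eq_of_squarefree_of_mul_sq_eq {d e : ℕ} (hd : Squarefree d) (he : Squarefree e) {q : ℚ}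
    (h : (e : ℚ) * q ^ 2 = d) : d = e := by
  obtain ⟨n, rfl⟩ := exists_int_of_squarefree_mul_sq_eq he (m := d) (by exact_mod_cast h)
  have hde : e * n.natAbs ^ 2 = d := by
    zify
    rw [sq_abs]
    exact_mod_cast h
  have hn : n.natAbs = 1 := Nat.isUnit_iff.mp (hd _ ⟨e, by rw [← hde]; ring⟩)
  rw [← hde, hn, one_pow, mul_one]

theorem emod_two_eq_of_four_dvd_sq_sub {A B d : ℤ} (hd : d % 4 = 1)
    (h : 4 ∣ A ^ 2 - d * B ^ 2) : A % 2 = B % 2 := by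
  obtain ⟨k, hk⟩ := h
  obtain ⟨m, rfl⟩ : ∃ m, d = 4 * m + 1 := ⟨d / 4, by omega⟩
  obtain ⟨a, rfl | rfl⟩ := A.even_or_odd' <;> obtain ⟨b, rfl | rfl⟩ := B.even_or_odd' <;>
    ring_nf at hk <;> omega

theorem even_and_even_of_four_dvd_sq_sub {A B d : ℤ} (hd : d % 4 = 3)
    (h : 4 ∣ A ^ 2 - d * B ^ 2) : Even A ∧ Even B := by
  simp only [Int.even_iff]
  obtain ⟨k, hk⟩ := h
  obtain ⟨m, rfl⟩ : ∃ m, d = 4 * m + 3 := ⟨d / 4, by omega⟩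
  obtain ⟨a, rfl | rfl⟩ := A.even_or_odd' <;> obtain ⟨b, rfl | rfl⟩ := B.even_or_odd' <;>
    ring_nf at hk <;> omega

theorem discr_eq_of_isIntegral_of_mem_span {K ι : Type*} [Field K] [NumberField K] [Fintype ι]
    [DecidableEq ι] {b : ι → K} (hcard : Fintype.card ι = Module.finrank ℚ K)
    (hint : ∀ i, IsIntegral ℤ (b i))
    (hspan : ∀ x : K, IsIntegral ℤ x → x ∈ Submodule.span ℤ (Set.range b)) :
    (NumberField.discr K : ℚ) = Algebra.discr ℚ b := by
  have htop : ⊤ ≤ Submodule.span ℚ (Set.range b) := by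
    intro x _
    have hx : IsAlgebraic ℤ x :=
      (IsFractionRing.isAlgebraic_iff ℤ ℚ K).mpr (Algebra.IsAlgebraic.isAlgebraic x)
    obtain ⟨n, hn, hnx⟩ := hx.exists_integral_multiple
    have hmem := Submodule.span_le_restrictScalars ℤ ℚ _ (hspan _ hnx)
    have hmem_div := Submodule.smul_mem _ (n : ℚ)⁻¹ hmem
    rwa [← Int.cast_smul_eq_zsmul ℚ, smul_smul, inv_mul_cancel₀ (Int.cast_ne_zero.mpr hn),
      one_smul] at hmem_div
  let B := Module.Basis.mk (linearIndependent_of_top_le_span_of_card_eq_finrank htop hcard) htop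
  have hB : ⇑B = b := Module.Basis.coe_mk _ _
  rw [NumberField.coe_discr, ← hB]
  refine (Algebra.discr_eq_discr_of_toMatrix_coeff_isIntegral K (fun i j ↦ ?_) fun i j ↦ ?_).symm
  · obtain ⟨n, hn⟩ := (Submodule.mem_span_range_iff_exists_fun ℤ).mp (hspan
      (NumberField.integralBasis K j) (by
        rw [NumberField.integralBasis_apply]
        exact NumberField.RingOfIntegers.isIntegral_coe _))
    simp only [← Int.cast_smul_eq_zsmul ℚ, ← hB] at hn
    rw [Module.Basis.toMatrix_apply, ← hn, Module.Basis.repr_sum_self]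
    exact isIntegral_intCast _
  · obtain ⟨y, hy⟩ := (IsIntegralClosure.isIntegral_iff
      (A := NumberField.RingOfIntegers K)).mp (hint j)
    rw [Module.Basis.toMatrix_apply, hB, ← hy, NumberField.integralBasis_repr_apply]
    exact isIntegral_algebraMap

end IntegralityLemmas

/-- The hypotheses say that `(a + b√(uv) + c√(uw) + d√(vw))²` is rational. -/
theorem three_coords_eq_zero_of_cross_terms_eq_zero {F : Type*} [Field F] {u v w a b c d : F}
    (hu : u ≠ 0) (hvw : ¬IsSquare (v * w)) (hr : a * b + c * d * w = 0)
    (hs : a * c + b * d * v = 0) (ht : a * d + b * c * u = 0) :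
    (b = 0 ∧ c = 0 ∧ d = 0) ∨ (a = 0 ∧ c = 0 ∧ d = 0) ∨ (a = 0 ∧ b = 0 ∧ d = 0) ∨
      (a = 0 ∧ b = 0 ∧ c = 0) := by
  have hv : v ≠ 0 := by rintro rfl; simp at hvw
  have hw : w ≠ 0 := by rintro rfl; simp at hvw
  by_cases ha : a = 0
  · simp only [ha, hu, hv, hw, zero_mul, zero_add, mul_eq_zero, or_false] at hr hs ht
    tauto
  have hd : d = 0 := by
    by_contra hd
    have hbc : b * c ≠ 0 := fun hbc ↦ mul_ne_zero ha hd (by linear_combination ht - u * hbc)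
    have hsq : a ^ 2 = d ^ 2 * (v * w) :=
      mul_left_cancel₀ hbc (by linear_combination a * c * hr - c * d * w * hs)
    exact hvw ⟨a / d, by field_simp; linear_combination -hsq⟩
  simp_all

/-- `r`, `s`, `t` multiply like `√(uv)`, `√(uw)`, `√(vw)`. -/
structure IsSqrtTriple {K : Type*} [CommRing K] (u v w : ℕ) (r s t : K) : Prop where
  mul_rs : r * s = u * t
  mul_rt : r * t = v * s
  mul_st : s * t = w * r
  sq_r : r ^ 2 = u * v
  sq_s : s ^ 2 = u * w
  sq_t : t ^ 2 = v * w

namespace IsSqrtTriple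

variable {u v w : ℕ}

theorem swap_rs {K : Type*} [CommRing K] {r s t : K} (h : IsSqrtTriple u v w r s t) :
    IsSqrtTriple u w v s r t where
  mul_rs := by rw [mul_comm, h.mul_rs]
  mul_rt := h.mul_st
  mul_st := h.mul_rt
  sq_r := h.sq_s
  sq_s := h.sq_r
  sq_t := by rw [h.sq_t, mul_comm]

theorem swap_st {K : Type*} [CommRing K] {r s t : K} (h : IsSqrtTriple u v w r s t) :
    IsSqrtTriple v u w r t s where
  mul_rs := h.mul_rt
  mul_rt := h.mul_rs
  mul_st := by rw [mul_comm, h.mul_st]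
  sq_r := by rw [h.sq_r, mul_comm]
  sq_s := h.sq_t
  sq_t := h.sq_s

theorem mul_formula {K : Type*} [CommRing K] {r s t : K} (h : IsSqrtTriple u v w r s t)
    (a b c d a' b' c' d' : K) :
    (a + b * r + c * s + d * t) * (a' + b' * r + c' * s + d' * t) =
      (a * a' + b * b' * (u * v) + c * c' * (u * w) + d * d' * (v * w)) +
      (a * b' + a' * b + (c * d' + d * c') * w) * r +
      (a * c' + a' * c + (b * d' + d * b') * v) * s +
      (a * d' + a' * d + (b * c' + c * b') * u) * t := by
  linear_combination (b * b') * h.sq_r + (c * c') * h.sq_s + (d * d') * h.sq_t +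
    (b * c' + c * b') * h.mul_rs + (b * d' + d * b') * h.mul_rt + (c * d' + d * c') * h.mul_st

variable {K : Type*} [Field K] [CharZero K] {r s t : K}

theorem mul_eq_of_add_eq_zero (h : IsSqrtTriple u v w r s t) (hr : r ∉ Set.range ((↑) : ℚ → K))
    {a b c d : ℚ} (h0 : (a : K) + b * r + c * s + d * t = 0) : a * b = c * d * w := by
  by_contra hne
  refine hr ⟨-(a ^ 2 + b ^ 2 * (u * v) - c ^ 2 * (u * w) - d ^ 2 * (v * w)) /
    (2 * (a * b - c * d * w)), ?_⟩
  have hne' : (2 * (a * b - c * d * w) : K) ≠ 0 := by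
    exact_mod_cast mul_ne_zero two_ne_zero (sub_ne_zero.mpr hne)
  push_cast
  rw [div_eq_iff hne']
  linear_combination -(a + b * r - c * s - d * t) * h0 + b ^ 2 * h.sq_r - c ^ 2 * h.sq_s -
    d ^ 2 * h.sq_t - 2 * c * d * h.mul_st

end IsSqrtTriple

/-- `1, r, s, t` is a `ℚ`-basis of `K` multiplying like `1, √(uv), √(uw), √(vw)`. Linear
independence and spanning are spelled out in coordinates. -/
structure BiquadraticFrame {K : Type*} [Field K] [CharZero K] (u v w : ℕ) (r s t : K) : Prop
    extends IsSqrtTriple u v w r s t where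
  indep : ∀ a b c d : ℚ, (a : K) + b * r + c * s + d * t = 0 → a = 0 ∧ b = 0 ∧ c = 0 ∧ d = 0
  span : ∀ x : K, ∃ a b c d : ℚ, x = a + b * r + c * s + d * t

namespace BiquadraticFrame

variable {K : Type*} [Field K] [CharZero K] {u v w : ℕ} {r s t : K}

theorem swap_rs (h : BiquadraticFrame u v w r s t) : BiquadraticFrame u w v s r t where
  toIsSqrtTriple := h.toIsSqrtTriple.swap_rs
  indep a b c d h0 := by
    obtain ⟨ha, hc, hb, hd⟩ := h.indep a c b d (by linear_combination h0)
    exact ⟨ha, hb, hc, hd⟩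
  span x := by
    obtain ⟨a, b, c, d, rfl⟩ := h.span x
    exact ⟨a, c, b, d, by ring⟩

theorem swap_st (h : BiquadraticFrame u v w r s t) : BiquadraticFrame v u w r t s where
  toIsSqrtTriple := h.toIsSqrtTriple.swap_st
  indep a b c d h0 := by
    obtain ⟨ha, hb, hd, hc⟩ := h.indep a b d c (by linear_combination h0)
    exact ⟨ha, hb, hc, hd⟩
  span x := by
    obtain ⟨a, b, c, d, rfl⟩ := h.span x
    exact ⟨a, b, d, c, by ring⟩

theorem not_isSquare_mul (h : BiquadraticFrame u v w r s t) : ¬IsSquare ((u : ℚ) * v) := by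
  rintro ⟨q, hq⟩
  have hr : r ^ 2 = (q : K) ^ 2 := by
    rw [h.sq_r, sq]
    exact_mod_cast congrArg (Rat.cast (K := K)) hq
  obtain hr | hr := sq_eq_sq_iff_eq_or_eq_neg.mp hr
  · simpa using (h.indep (-q) 1 0 0 (by simp [hr])).2.1
  · simpa using (h.indep q 1 0 0 (by simp [hr])).2.1

theorem eq_mul_of_sq_eq (h : BiquadraticFrame u v w r s t) (huv : Squarefree (u * v))
    (huw : Squarefree (u * w)) (hvw : Squarefree (v * w)) {n : ℕ} (hn : Squarefree n)
    (hn1 : n ≠ 1) {x : K} (hx : x ^ 2 = n) : n = u * v ∨ n = u * w ∨ n = v * w := by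
  obtain ⟨a, b, c, d, rfl⟩ := h.span x
  rw [pow_two, h.mul_formula] at hx
  obtain ⟨h1, hr, hs, ht⟩ := h.indep
    (a * a + b * b * (u * v) + c * c * (u * w) + d * d * (v * w) - n)
    (a * b + a * b + (c * d + d * c) * w) (a * c + a * c + (b * d + d * b) * v)
    (a * d + a * d + (b * c + c * b) * u) (by push_cast; linear_combination hx)
  have hu : (u : ℚ) ≠ 0 := Nat.cast_ne_zero.mpr (left_ne_zero_of_mul huv.ne_zero)
  rcases three_coords_eq_zero_of_cross_terms_eq_zero (a := a) (b := b) (c := c) (d := d) hu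
      h.swap_st.swap_rs.not_isSquare_mul (by linear_combination hr / 2)
      (by linear_combination hs / 2) (by linear_combination ht / 2)
    with ⟨rfl, rfl, rfl⟩ | ⟨rfl, rfl, rfl⟩ | ⟨rfl, rfl, rfl⟩ | ⟨rfl, rfl, rfl⟩
  · exact absurd (eq_of_squarefree_of_mul_sq_eq hn squarefree_one (q := a)
      (by push_cast; linear_combination h1)) hn1
  · exact .inl (eq_of_squarefree_of_mul_sq_eq hn huv (q := b)
      (by push_cast; linear_combination h1))
  · exact .inr (.inl (eq_of_squarefree_of_mul_sq_eq hn huw (q := c)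
      (by push_cast; linear_combination h1)))
  · exact .inr (.inr (eq_of_squarefree_of_mul_sq_eq hn hvw (q := d)
      (by push_cast; linear_combination h1)))

/-- The `ℚ`-basis `1, r, s, t`. -/
noncomputable def basis (h : BiquadraticFrame u v w r s t) : Module.Basis (Fin 4) ℚ K :=
  Module.Basis.mk (v := ![1, r, s, t])
    (by
      rw [Fintype.linearIndependent_iff]
      intro g hg
      simp only [Fin.sum_univ_four, Rat.smul_def] at hg
      obtain ⟨h0, h1, h2, h3⟩ := h.indep (g 0) (g 1) (g 2) (g 3) (by simpa using hg)
      intro i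
      fin_cases i <;> assumption)
    (by
      intro x _
      obtain ⟨a, b, c, d, rfl⟩ := h.span x
      rw [Submodule.mem_span_range_iff_exists_fun]
      exact ⟨![a, b, c, d], by simp [Fin.sum_univ_four, Rat.smul_def]⟩)

theorem coe_basis (h : BiquadraticFrame u v w r s t) : ⇑h.basis = ![1, r, s, t] :=
  Module.Basis.coe_mk _ _

theorem finrank_eq (h : BiquadraticFrame u v w r s t) : Module.finrank ℚ K = 4 := by
  simpa using Module.finrank_eq_card_basis h.basis

theorem exists_conj (h : BiquadraticFrame u v w r s t) :
    ∃ σ : K →ₐ[ℚ] K, σ r = r ∧ σ s = -s ∧ σ t = -t := by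
  let L : K →ₗ[ℚ] K := h.basis.constr ℚ ![1, r, -s, -t]
  have hL (i : Fin 4) : L (![1, r, s, t] i) = ![1, r, -s, -t] i := by
    rw [← h.coe_basis]
    exact h.basis.constr_basis _ _ i
  have hL_coords (a b c d : ℚ) : L (a + b * r + c * s + d * t) = a + b * r - c * s - d * t := by
    calc L (a + b * r + c * s + d * t) = L (a • 1 + b • r + c • s + d • t) := by
          simp only [Rat.smul_def, mul_one]
      _ = a • L 1 + b • L r + c • L s + d • L t := by simp only [map_add, map_smul]
      _ = a • 1 + b • r + c • -s + d • -t := by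
          rw [show L 1 = 1 from hL 0, show L r = r from hL 1, show L s = -s from hL 2,
            show L t = -t from hL 3]
      _ = a + b * r - c * s - d * t := by simp only [Rat.smul_def]; ring
  refine ⟨AlgHom.ofLinearMap L (hL 0) fun x y ↦ ?_, hL 1, hL 2, hL 3⟩
  obtain ⟨a, b, c, d, rfl⟩ := h.span x
  obtain ⟨a', b', c', d', rfl⟩ := h.span y
  have hL_mul := hL_coords (a * a' + b * b' * (u * v) + c * c' * (u * w) + d * d' * (v * w))
    (a * b' + a' * b + (c * d' + d * c') * w) (a * c' + a' * c + (b * d' + d * b') * v)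
    (a * d' + a' * d + (b * c' + c * b') * u)
  push_cast at hL_mul
  rw [h.mul_formula, hL_mul, hL_coords, hL_coords]
  linear_combination -h.mul_formula a b (-c) (-d) a' b' (-c') (-d')

theorem isIntegral_conj (h : BiquadraticFrame u v w r s t) {a b c d : ℚ}
    (hx : IsIntegral ℤ ((a : K) + b * r + c * s + d * t)) :
    IsIntegral ℤ ((a : K) + b * r - c * s - d * t) := by
  obtain ⟨σ, hr, hs, ht⟩ := h.exists_conj
  convert hx.map (σ.restrictScalars ℤ) using 1
  simp only [AlgHom.coe_restrictScalars', map_add, map_mul, map_ratCast, hr, hs, ht]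
  ring

theorem trace_r (h : BiquadraticFrame u v w r s t) : Algebra.trace ℚ K r = 0 := by
  have : FiniteDimensional ℚ K := .of_basis h.basis
  obtain ⟨σ, -, hr, -⟩ := h.swap_rs.exists_conj
  have htrace := Algebra.trace_eq_of_algEquiv (AlgEquiv.ofBijective σ σ.bijective) r
  simp only [AlgEquiv.coe_ofBijective, hr, map_neg] at htrace
  linarith

theorem trace_eq (h : BiquadraticFrame u v w r s t) (a b c d : ℚ) :
    Algebra.trace ℚ K (a + b * r + c * s + d * t) = 4 * a := by
  have hsmul : (a : K) + b * r + c * s + d * t = algebraMap ℚ K a + b • r + c • s + d • t := by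
    simp only [Rat.smul_def, eq_ratCast]
  rw [hsmul]
  simp only [map_add, map_smul, Algebra.trace_algebraMap, h.finrank_eq, h.trace_r,
    h.swap_rs.trace_r, h.swap_st.swap_rs.trace_r, smul_zero, add_zero, nsmul_eq_mul,
    Nat.cast_ofNat]

theorem trace_mul_eq (h : BiquadraticFrame u v w r s t) (a b c d a' b' c' d' : ℚ) :
    Algebra.trace ℚ K ((a + b * r + c * s + d * t) * (a' + b' * r + c' * s + d' * t)) =
      4 * (a * a' + b * b' * (u * v) + c * c' * (u * w) + d * d' * (v * w)) := by
  rw [h.mul_formula]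
  exact_mod_cast h.trace_eq _ (a * b' + a' * b + (c * d' + d * c') * w)
    (a * c' + a' * c + (b * d' + d * b') * v) (a * d' + a' * d + (b * c' + c * b') * u)

theorem discr_basis (h : BiquadraticFrame u v w r s t) :
    Algebra.discr ℚ h.basis = 256 * ((u : ℚ) * v * w) ^ 2 := by
  let δ (i j : Fin 4) : ℚ := if i = j then 1 else 0
  have hcoords (i : Fin 4) :
      h.basis i = (δ i 0 : K) + δ i 1 * r + δ i 2 * s + δ i 3 * t := by
    rw [h.coe_basis]
    fin_cases i <;> simp [δ]
  have hM : Algebra.traceMatrix ℚ h.basis =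
      Matrix.diagonal ![4, 4 * ((u : ℚ) * v), 4 * ((u : ℚ) * w), 4 * ((v : ℚ) * w)] := by
    ext i j
    rw [Algebra.traceMatrix_apply, Algebra.traceForm_apply, hcoords i, hcoords j, h.trace_mul_eq]
    fin_cases i <;> fin_cases j <;> simp [δ]
  rw [Algebra.discr_def, hM, Matrix.det_diagonal, Fin.prod_univ_four]
  simp only [Matrix.cons_val]
  ring

end BiquadraticFrame

namespace BiquadraticFrame

section Integers

variable {K : Type*} [Field K] [CharZero K] {u v w : ℕ} {r s t : K}

theorem exists_two_mul_eq_of_isIntegral (h : BiquadraticFrame u v w r s t)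
    (huv : Squarefree (u * v)) {a b : ℚ} (hx : IsIntegral ℤ ((a : K) + b * r)) :
    ∃ A B : ℤ, 2 * a = A ∧ 2 * b = B ∧ 4 ∣ A ^ 2 - (u * v : ℕ) * B ^ 2 := by
  have hconj : IsIntegral ℤ ((a : K) - b * r) := by
    simpa using h.swap_rs.isIntegral_conj (a := a) (b := 0) (c := b) (d := 0) (by simpa using hx)
  have htrace : ((2 * a : ℚ) : K) = (a + b * r) + (a - b * r) := by push_cast; ring
  have hnorm : ((a ^ 2 - u * v * b ^ 2 : ℚ) : K) = (a + b * r) * (a - b * r) := by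
    push_cast
    linear_combination (b : K) ^ 2 * h.sq_r
  obtain ⟨A, hA⟩ := exists_int_of_isIntegral_ratCast (htrace ▸ hx.add hconj)
  obtain ⟨n, hn⟩ := exists_int_of_isIntegral_ratCast (hnorm ▸ hx.mul hconj)
  obtain ⟨B, hB⟩ := exists_int_of_squarefree_mul_sq_eq huv (q := 2 * b) (m := A ^ 2 - 4 * n) (by
    push_cast
    rw [← hA, ← hn]
    ring)
  have hnorm_int : (A : ℚ) ^ 2 - (u * v : ℕ) * B ^ 2 = 4 * n := by
    rw [← hA, ← hB, ← hn]
    push_cast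
    ring
  exact ⟨A, B, hA, hB, n, by exact_mod_cast hnorm_int⟩

/-- The trace of `x` to the subfield generated by `r` is `2 (a + b r)`. -/
theorem exists_four_mul_eq_of_isIntegral (h : BiquadraticFrame u v w r s t)
    (huv : Squarefree (u * v)) {a b c d : ℚ}
    (hx : IsIntegral ℤ ((a : K) + b * r + c * s + d * t)) :
    ∃ A B : ℤ, 4 * a = A ∧ 4 * b = B ∧ 4 ∣ A ^ 2 - (u * v : ℕ) * B ^ 2 := by
  have htrace : ((2 * a : ℚ) : K) + (2 * b : ℚ) * r =
      (a + b * r + c * s + d * t) + (a + b * r - c * s - d * t) := by push_cast; ring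
  obtain ⟨A, B, hA, hB, hAB⟩ :=
    h.exists_two_mul_eq_of_isIntegral huv (htrace ▸ hx.add (h.isIntegral_conj hx))
  exact ⟨A, B, by rw [← hA]; ring, by rw [← hB]; ring, hAB⟩

theorem exists_int_coords_of_isIntegral (h : BiquadraticFrame u v w r s t)
    (hsq : Squarefree (u * v * w)) {x : K} (hx : IsIntegral ℤ x) :
    ∃ A B C D : ℤ, 4 * x = A + B * r + C * s + D * t ∧ 4 ∣ A ^ 2 - (u * v : ℕ) * B ^ 2 ∧
      4 ∣ A ^ 2 - (u * w : ℕ) * C ^ 2 ∧ 4 ∣ A ^ 2 - (v * w : ℕ) * D ^ 2 := by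
  obtain ⟨a, b, c, d, rfl⟩ := h.span x
  obtain ⟨A, B, hA, hB, hAB⟩ :=
    h.exists_four_mul_eq_of_isIntegral (hsq.squarefree_of_dvd ⟨w, rfl⟩) hx
  obtain ⟨A', C, hA', hC, hAC⟩ := h.swap_rs.exists_four_mul_eq_of_isIntegral
    (hsq.squarefree_of_dvd ⟨v, by ring⟩) (a := a) (b := c) (c := b) (d := d)
    (by convert hx using 1; ring)
  obtain ⟨A'', D, hA'', hD, hAD⟩ := h.swap_st.swap_rs.exists_four_mul_eq_of_isIntegral
    (hsq.squarefree_of_dvd ⟨u, by ring⟩) (a := a) (b := d) (c := b) (d := c)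
    (by convert hx using 1; ring)
  obtain rfl : A' = A := by exact_mod_cast hA'.symm.trans hA
  obtain rfl : A'' = A' := by exact_mod_cast hA''.symm.trans hA
  refine ⟨A'', B, C, D, ?_, hAB, hAC, hAD⟩
  have hcast {q : ℚ} {n : ℤ} (hq : 4 * q = n) : (n : K) = 4 * q := by
    exact_mod_cast (congrArg (Rat.cast (K := K)) hq).symm
  rw [hcast hA, hcast hB, hcast hC, hcast hD]
  ring

end Integers

variable {K : Type*} [Field K] [NumberField K] {u v w : ℕ} {r s t : K}

theorem discr_eq_det_sq (h : BiquadraticFrame u v w r s t) (P : Matrix (Fin 4) (Fin 4) ℚ)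
    {b : Fin 4 → K} (hb : b = (P.map (algebraMap ℚ K)).mulVec ![1, r, s, t])
    (hint : ∀ i, IsIntegral ℤ (b i))
    (hspan : ∀ x : K, IsIntegral ℤ x → x ∈ Submodule.span ℤ (Set.range b)) :
    (NumberField.discr K : ℚ) = P.det ^ 2 * (256 * ((u : ℚ) * v * w) ^ 2) := by
  have hcard : Fintype.card (Fin 4) = Module.finrank ℚ K := by rw [h.finrank_eq, Fintype.card_fin]
  rw [discr_eq_of_isIntegral_of_mem_span hcard hint hspan, hb, ← h.coe_basis,
    Algebra.discr_of_matrix_mulVec, h.discr_basis]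

end BiquadraticFrame

section IntegralElements

theorem IsSqrtTriple.isIntegral_r {K : Type*} [CommRing K] {u v w : ℕ} {r s t : K}
    (h : IsSqrtTriple u v w r s t) : IsIntegral ℤ r :=
  isIntegral_of_sq_eq_add 0 (u * v) (by push_cast; linear_combination h.sq_r)

variable {K : Type*} [Field K] [CharZero K] {u v w : ℕ} {r s t : K}

namespace IsSqrtTriple

theorem isIntegral_one_add_div_two (h : IsSqrtTriple u v w r s t) (huv : u * v % 4 = 1) :
    IsIntegral ℤ ((1 + r) / 2) := by
  obtain ⟨k, hk⟩ : ∃ k : ℕ, u * v = 4 * k + 1 := ⟨u * v / 4, by omega⟩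
  have hkK : (u : K) * v = 4 * k + 1 := by exact_mod_cast hk
  refine isIntegral_of_sq_eq_add 1 k ?_
  push_cast
  linear_combination (1 / 4 : K) * h.sq_r + (1 / 4 : K) * hkK

/-- The product of `(1 + r) / 2` and `(1 + s) / 2` is `(1 + r + s + u t) / 4`. -/
theorem isIntegral_div_four (h : IsSqrtTriple u v w r s t) {ε : ℤ} (hε : 4 ∣ u - ε)
    (huv : u * v % 4 = 1) (huw : u * w % 4 = 1) :
    IsIntegral ℤ ((1 + r + s + ε * t) / 4) := by
  obtain ⟨k, hk⟩ := hε
  have hkK : (u : K) - ε = 4 * k := by exact_mod_cast congrArg (Int.cast (R := K)) hk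
  have hmul : (1 + r + s + ε * t) / 4 = (1 + r) / 2 * ((1 + s) / 2) - k * t := by
    linear_combination (-1 / 4 : K) * h.mul_rs - (1 / 4 : K) * t * hkK
  rw [hmul]
  exact ((h.isIntegral_one_add_div_two huv).mul (h.swap_rs.isIntegral_one_add_div_two huw)).sub
    ((isIntegral_intCast k).mul h.swap_st.swap_rs.isIntegral_r)

theorem isIntegral_add_div_two (h : IsSqrtTriple u v w r s t) (huv : (u + v) % 4 = 2)
    (hr : IsIntegral ℤ ((1 + r) / 2)) : IsIntegral ℤ ((s + t) / 2) := by
  obtain ⟨k, hk⟩ : ∃ k : ℕ, u + v = 4 * k + 2 := ⟨(u + v) / 4, by omega⟩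
  have hkK : (u : K) + v = 4 * k + 2 := by exact_mod_cast hk
  have hsq : ((s + t) / 2) ^ 2 = w * (k + (1 + r) / 2) := by
    linear_combination (1 / 4 : K) * h.sq_s + (1 / 4 : K) * h.sq_t + (1 / 2 : K) * h.mul_st +
      (w / 4 : K) * hkK
  refine IsIntegral.of_pow two_pos ?_
  rw [hsq]
  exact (isIntegral_natCast w).mul ((isIntegral_natCast k).add hr)

end IsSqrtTriple

namespace BiquadraticFrame

theorem mem_span_of_forall_mul_emod_four_eq_one (h : BiquadraticFrame u v w r s t)
    (hsq : Squarefree (u * v * w)) (huv : u * v % 4 = 1) (huw : u * w % 4 = 1)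
    (hvw : v * w % 4 = 1) {ε : ℤ} (hε : ε * ε = 1) (huε : 4 ∣ u - ε) {x : K}
    (hx : IsIntegral ℤ x) : x ∈ Submodule.span ℤ
      (Set.range ![1, (1 + r) / 2, (1 + s) / 2, (1 + r + s + ε * t) / 4]) := by
  obtain ⟨A, B, C, D, hABCD, hAB, hAC, hAD⟩ := h.exists_int_coords_of_isIntegral hsq hx
  have hB := emod_two_eq_of_four_dvd_sq_sub (by exact_mod_cast huv) hAB
  have hC := emod_two_eq_of_four_dvd_sq_sub (by exact_mod_cast huw) hAC
  have hD := emod_two_eq_of_four_dvd_sq_sub (by exact_mod_cast hvw) hAD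
  have hεD : (ε * D) % 2 = D % 2 := by
    obtain rfl | rfl := mul_self_eq_one_iff.mp hε <;> omega
  obtain ⟨m, hm⟩ : ∃ m, B = ε * D + 2 * m := ⟨(B - ε * D) / 2, by omega⟩
  obtain ⟨n, hn⟩ : ∃ n, C = ε * D + 2 * n := ⟨(C - ε * D) / 2, by omega⟩
  have hεK : (ε : K) * ε = 1 := by exact_mod_cast congrArg (Int.cast (R := K)) hε
  rw [hm, hn] at hABCD
  push_cast at hABCD
  have hy : IsIntegral ℤ (x - m * ((1 + r) / 2) - n * ((1 + s) / 2) -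
      (ε * D : ℤ) * ((1 + r + s + ε * t) / 4)) :=
    ((hx.sub ((isIntegral_intCast m).mul (h.isIntegral_one_add_div_two huv))).sub
      ((isIntegral_intCast n).mul (h.swap_rs.isIntegral_one_add_div_two huw))).sub
      ((isIntegral_intCast _).mul (h.isIntegral_div_four huε huv huw))
  obtain ⟨l, hl⟩ := exists_int_of_isIntegral_of_mul_eq_intCast hy (m := 4)
    (z := A - 2 * m - 2 * n - ε * D) (by norm_num)
    (by push_cast; linear_combination hABCD - D * t * hεK)
  refine (Submodule.mem_span_range_iff_exists_fun ℤ).mpr ⟨![l, m, n, ε * D], ?_⟩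
  simp only [Fin.sum_univ_four, Matrix.cons_val, zsmul_eq_mul]
  linear_combination -hl

theorem mem_span_of_mul_emod_four_eq_three (h : BiquadraticFrame u v w r s t)
    (hsq : Squarefree (u * v * w)) (huv : u * v % 4 = 1) (huw : u * w % 4 = 3)
    (hvw : v * w % 4 = 3) (hst : IsIntegral ℤ ((s + t) / 2)) {x : K} (hx : IsIntegral ℤ x) :
    x ∈ Submodule.span ℤ (Set.range ![1, (1 + r) / 2, s, (s + t) / 2]) := by
  obtain ⟨A, B, C, D, hABCD, hAB, hAC, hAD⟩ := h.exists_int_coords_of_isIntegral hsq hx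
  have hB := emod_two_eq_of_four_dvd_sq_sub (by exact_mod_cast huv) hAB
  obtain ⟨hA, -⟩ := even_and_even_of_four_dvd_sq_sub (by exact_mod_cast huw) hAC
  obtain ⟨-, hD⟩ := even_and_even_of_four_dvd_sq_sub (by exact_mod_cast hvw) hAD
  obtain ⟨n, rfl⟩ := hD.two_dvd
  obtain ⟨m, rfl⟩ : ∃ m, B = 2 * m := ⟨B / 2, by rw [Int.even_iff] at hA; omega⟩
  push_cast at hABCD
  have hy_eq : (((A - 2 * m) / 4 : ℚ) : K) + ((C - 2 * n) / 4 : ℚ) * s =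
      x - m * ((1 + r) / 2) - n * ((s + t) / 2) := by
    push_cast
    linear_combination -hABCD / 4
  have hy := (hx.sub ((isIntegral_intCast m).mul (h.isIntegral_one_add_div_two huv))).sub
    ((isIntegral_intCast n).mul hst)
  obtain ⟨A', C', hA', hC', hAC'⟩ := h.swap_rs.exists_two_mul_eq_of_isIntegral
    (hsq.squarefree_of_dvd ⟨v, by ring⟩) (hy_eq ▸ hy)
  obtain ⟨hA'_even, hC'_even⟩ := even_and_even_of_four_dvd_sq_sub (by exact_mod_cast huw) hAC'
  obtain ⟨l, rfl⟩ := hA'_even.two_dvd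
  obtain ⟨q, rfl⟩ := hC'_even.two_dvd
  have hl : (A - 2 * m : K) = 4 * l := by
    have : (A - 2 * m : ℚ) = 4 * l := by push_cast at hA'; linarith
    exact_mod_cast congrArg (Rat.cast (K := K)) this
  have hq : (C - 2 * n : K) = 4 * q := by
    have : (C - 2 * n : ℚ) = 4 * q := by push_cast at hC'; linarith
    exact_mod_cast congrArg (Rat.cast (K := K)) this
  refine (Submodule.mem_span_range_iff_exists_fun ℤ).mpr ⟨![l, m, q, n], ?_⟩
  simp only [Fin.sum_univ_four, Matrix.cons_val, zsmul_eq_mul]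
  linear_combination (-hABCD - hl - s * hq) / 4

end BiquadraticFrame

end IntegralElements

theorem mul_emod_four_eq_one {u v : ℕ} (hu : Odd u) (huv : u % 4 = v % 4) : u * v % 4 = 1 := by
  obtain hu | hu := Nat.odd_mod_four_iff.mp (Nat.odd_iff.mp hu) <;>
    rw [Nat.mul_mod, ← huv, hu]

theorem mul_emod_four_eq_three {u v : ℕ} (hu : Odd u) (hv : Odd v) (huv : u % 4 ≠ v % 4) :
    u * v % 4 = 3 := by
  obtain hu | hu := Nat.odd_mod_four_iff.mp (Nat.odd_iff.mp hu) <;>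
    obtain hv | hv := Nat.odd_mod_four_iff.mp (Nat.odd_iff.mp hv) <;>
    simp [Nat.mul_mod, hu, hv] at huv ⊢

/-- The congruence condition that decides whether the discriminant of `ℚ(√(uv), √(uw))` is odd. -/
def AgreeModFour (p : ℕ × ℕ × ℕ) : Prop := p.1 % 4 = p.2.1 % 4 ∧ p.2.1 % 4 = p.2.2 % 4

instance : DecidablePred AgreeModFour := fun p ↦
  inferInstanceAs (Decidable (p.1 % 4 = p.2.1 % 4 ∧ p.2.1 % 4 = p.2.2 % 4))

/-- The discriminant of `ℚ(√(uv), √(uw))` for pairwise coprime odd squarefree `u`, `v`, `w`. -/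
def tripleDiscr (p : ℕ × ℕ × ℕ) : ℕ :=
  (if AgreeModFour p then 1 else 16) * (p.1 * p.2.1 * p.2.2) ^ 2

namespace BiquadraticFrame

variable {K : Type*} [Field K] [NumberField K] {u v w : ℕ} {r s t : K}

theorem discr_eq_of_emod_four_eq (h : BiquadraticFrame u v w r s t) (hodd : Odd (u * v * w))
    (hsq : Squarefree (u * v * w)) (huv : u % 4 = v % 4) (hvw : v % 4 = w % 4) :
    NumberField.discr K = ((u : ℤ) * v * w) ^ 2 := by
  have hu : Odd u := Nat.Odd.of_mul_left (Nat.Odd.of_mul_left hodd)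
  have hv : Odd v := Nat.Odd.of_mul_right (Nat.Odd.of_mul_left hodd)
  have huv' := mul_emod_four_eq_one hu huv
  have huw' := mul_emod_four_eq_one hu (huv.trans hvw)
  obtain ⟨ε, hε, huε⟩ : ∃ ε : ℤ, ε * ε = 1 ∧ 4 ∣ u - ε := by
    obtain hu | hu := Nat.odd_mod_four_iff.mp (Nat.odd_iff.mp hu)
    · exact ⟨1, by norm_num, by omega⟩
    · exact ⟨-1, by norm_num, by omega⟩
  let P : Matrix (Fin 4) (Fin 4) ℚ :=
    !![1, 0, 0, 0; 1/2, 1/2, 0, 0; 1/2, 0, 1/2, 0; 1/4, 1/4, 1/4, (ε : ℚ)/4]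
  have hdet : P.det = ε / 16 := by
    simp [P, Matrix.det_succ_row_zero, Fin.sum_univ_succ, Fin.succAbove]
    ring
  have hdiscr := h.discr_eq_det_sq P (b := ![1, (1 + r) / 2, (1 + s) / 2, (1 + r + s + ε * t) / 4])
    (by ext i; fin_cases i <;> simp [P, Matrix.mulVec, dotProduct, Fin.sum_univ_four] <;> ring)
    (by
      rw [Fin.forall_fin_succ, Fin.forall_fin_succ, Fin.forall_fin_two]
      exact ⟨isIntegral_one, h.isIntegral_one_add_div_two huv',
        h.swap_rs.isIntegral_one_add_div_two huw', h.isIntegral_div_four huε huv' huw'⟩)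
    (fun x ↦ h.mem_span_of_forall_mul_emod_four_eq_one hsq huv' huw' (mul_emod_four_eq_one hv hvw)
      hε huε)
  have hεQ : (ε : ℚ) * ε = 1 := by exact_mod_cast hε
  have hcast : (NumberField.discr K : ℚ) = ((u : ℚ) * v * w) ^ 2 := by
    rw [hdiscr, hdet]
    linear_combination ((u : ℚ) * v * w) ^ 2 * hεQ
  exact_mod_cast hcast

theorem discr_eq_of_emod_four_ne (h : BiquadraticFrame u v w r s t) (hodd : Odd (u * v * w))
    (hsq : Squarefree (u * v * w)) (huv : u % 4 = v % 4) (hvw : v % 4 ≠ w % 4) :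
    NumberField.discr K = 16 * ((u : ℤ) * v * w) ^ 2 := by
  have hu : Odd u := Nat.Odd.of_mul_left (Nat.Odd.of_mul_left hodd)
  have hv : Odd v := Nat.Odd.of_mul_right (Nat.Odd.of_mul_left hodd)
  have hw : Odd w := Nat.Odd.of_mul_right hodd
  have huv' := mul_emod_four_eq_one hu huv
  have hr := h.isIntegral_one_add_div_two huv'
  have hst := h.isIntegral_add_div_two (by rw [Nat.odd_iff] at hu; omega) hr
  let P : Matrix (Fin 4) (Fin 4) ℚ :=
    !![1, 0, 0, 0; 1/2, 1/2, 0, 0; 0, 0, 1, 0; 0, 0, 1/2, 1/2]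
  have hdet : P.det = 1 / 4 := by
    simp [P, Matrix.det_succ_row_zero, Fin.sum_univ_succ, Fin.succAbove]
    norm_num
  have hdiscr := h.discr_eq_det_sq P (b := ![1, (1 + r) / 2, s, (s + t) / 2])
    (by ext i; fin_cases i <;> simp [P, Matrix.mulVec, dotProduct, Fin.sum_univ_four] <;> ring)
    (by
      rw [Fin.forall_fin_succ, Fin.forall_fin_succ, Fin.forall_fin_two]
      exact ⟨isIntegral_one, hr, h.swap_rs.isIntegral_r, hst⟩)
    (fun x ↦ h.mem_span_of_mul_emod_four_eq_three hsq huv'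
      (mul_emod_four_eq_three hu hw (huv ▸ hvw)) (mul_emod_four_eq_three hv hw hvw) hst)
  have hcast : (NumberField.discr K : ℚ) = 16 * ((u : ℚ) * v * w) ^ 2 := by
    rw [hdiscr, hdet]
    ring
  exact_mod_cast hcast

theorem discr_eq (h : BiquadraticFrame u v w r s t) (hodd : Odd (u * v * w))
    (hsq : Squarefree (u * v * w)) : NumberField.discr K = tripleDiscr (u, v, w) := by
  have hu := Nat.odd_iff.mp (Nat.Odd.of_mul_left (Nat.Odd.of_mul_left hodd))
  have hv := Nat.odd_iff.mp (Nat.Odd.of_mul_right (Nat.Odd.of_mul_left hodd))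
  have hw := Nat.odd_iff.mp (Nat.Odd.of_mul_right hodd)
  rw [tripleDiscr]
  by_cases hagree : AgreeModFour (u, v, w)
  · rw [if_pos hagree, h.discr_eq_of_emod_four_eq hodd hsq hagree.1 hagree.2]
    push_cast
    ring
  rw [if_neg hagree]
  push_cast
  by_cases huv : u % 4 = v % 4
  · exact h.discr_eq_of_emod_four_ne hodd hsq huv fun hvw ↦ hagree ⟨huv, hvw⟩
  by_cases huw : u % 4 = w % 4
  · have hperm : u * w * v = u * v * w := by ring
    rw [h.swap_rs.discr_eq_of_emod_four_ne (by rwa [hperm]) (by rwa [hperm]) huw (by omega)]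
    ring
  · have hperm : v * w * u = u * v * w := by ring
    rw [h.swap_st.swap_rs.discr_eq_of_emod_four_ne (by rwa [hperm]) (by rwa [hperm]) (by omega)
      (by omega)]
    ring

end BiquadraticFrame

/-! ### Parametrisation of the fields by triples -/

section RealFields

theorem IsSqrtTriple.eq_zero_of_add_eq_zero {K : Type*} [Field K] [CharZero K] {u v w : ℕ}
    {r s t : K} (h : IsSqrtTriple u v w r s t) (hu : u ≠ 0) (hr : r ∉ Set.range ((↑) : ℚ → K))
    (hs : s ∉ Set.range ((↑) : ℚ → K)) (ht : t ∉ Set.range ((↑) : ℚ → K)) {a b c d : ℚ}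
    (h0 : (a : K) + b * r + c * s + d * t = 0) : a = 0 ∧ b = 0 ∧ c = 0 ∧ d = 0 := by
  have hvw : ¬IsSquare ((v : ℚ) * w) := by
    rintro ⟨q, hq⟩
    have hqK : (v : K) * w = q * q := by exact_mod_cast congrArg (Rat.cast (K := K)) hq
    have hsq : t ^ 2 = (q : K) ^ 2 := by linear_combination h.sq_t + hqK
    obtain rfl | rfl := sq_eq_sq_iff_eq_or_eq_neg.mp hsq
    · exact ht ⟨q, rfl⟩
    · exact ht ⟨-q, by push_cast; rfl⟩
  have ne_zero {x : K} (hx : x ∉ Set.range ((↑) : ℚ → K)) : x ≠ 0 := by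
    rintro rfl
    exact hx ⟨0, Rat.cast_zero⟩
  have hab := h.mul_eq_of_add_eq_zero hr h0
  have hac := h.swap_rs.mul_eq_of_add_eq_zero hs (a := a) (b := c) (c := b) (d := d)
    (by linear_combination h0)
  have had := h.swap_st.swap_rs.mul_eq_of_add_eq_zero ht (a := a) (b := d) (c := b) (d := c)
    (by linear_combination h0)
  obtain ⟨rfl, rfl, rfl⟩ | ⟨ha, rfl, rfl⟩ | ⟨ha, rfl, rfl⟩ | ⟨ha, rfl, rfl⟩ :=
    three_coords_eq_zero_of_cross_terms_eq_zero (a := -a) (b := b) (c := c) (d := d)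
      (Nat.cast_ne_zero.mpr hu) hvw (by linear_combination -hab) (by linear_combination -hac)
      (by linear_combination -had)
  · simpa using h0
  all_goals
    obtain rfl := neg_eq_zero.mp ha
    simpa [ne_zero hr, ne_zero hs, ne_zero ht] using h0

theorem irrational_sqrt_of_squarefree {d : ℕ} (hd : Squarefree d) (hd1 : d ≠ 1) :
    Irrational (√(d : ℝ)) := by
  rw [irrational_sqrt_natCast_iff]
  rintro ⟨m, rfl⟩
  exact hd1 (by rw [Nat.isUnit_iff.mp (hd m dvd_rfl)])

theorem sqrt_mul_sqrt_common (u v w : ℕ) :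
    √((u * v : ℕ) : ℝ) * √((u * w : ℕ) : ℝ) = u * √((v * w : ℕ) : ℝ) := by
  rw [← Real.sqrt_mul (by positivity)]
  have hmul : ((u * v : ℕ) : ℝ) * (u * w : ℕ) = u ^ 2 * (v * w : ℕ) := by push_cast; ring
  rw [hmul, Real.sqrt_mul (by positivity), Real.sqrt_sq (by positivity)]

theorem isSqrtTriple_sqrt (u v w : ℕ) :
    IsSqrtTriple u v w √((u * v : ℕ) : ℝ) √((u * w : ℕ) : ℝ) √((v * w : ℕ) : ℝ) where
  mul_rs := sqrt_mul_sqrt_common u v w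
  mul_rt := by rw [mul_comm u v, sqrt_mul_sqrt_common]
  mul_st := by rw [mul_comm u w, mul_comm v w, sqrt_mul_sqrt_common]
  sq_r := by rw [Real.sq_sqrt (by positivity), Nat.cast_mul]
  sq_s := by rw [Real.sq_sqrt (by positivity), Nat.cast_mul]
  sq_t := by rw [Real.sq_sqrt (by positivity), Nat.cast_mul]

/-- The real field `ℚ(√(uv), √(uw), √(vw))`, generated by a redundant third root so that it is
visibly symmetric in `u`, `v`, `w`. -/
noncomputable def biquadraticField (u v w : ℕ) : IntermediateField ℚ ℝ :=
  IntermediateField.adjoin ℚ {√((u * v : ℕ) : ℝ), √((u * w : ℕ) : ℝ), √((v * w : ℕ) : ℝ)}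

theorem biquadraticField_swap_right (u v w : ℕ) :
    biquadraticField u w v = biquadraticField u v w := by
  rw [biquadraticField, biquadraticField, Set.insert_comm, mul_comm w v]

theorem biquadraticField_swap_left (u v w : ℕ) :
    biquadraticField v u w = biquadraticField u v w := by
  rw [biquadraticField, biquadraticField, Set.pair_comm, mul_comm v u]

theorem isIntegral_sqrt_natCast (n : ℕ) : IsIntegral ℚ (√(n : ℝ)) := by
  refine IsIntegral.of_pow two_pos ?_
  rw [Real.sq_sqrt (by positivity)]
  exact isIntegral_natCast n

theorem exists_coords_of_mem_biquadraticField {u v w : ℕ} {x : ℝ}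
    (hx : x ∈ biquadraticField u v w) :
    ∃ a b c d : ℚ, x = a + b * √((u * v : ℕ) : ℝ) + c * √((u * w : ℕ) : ℝ) +
      d * √((v * w : ℕ) : ℝ) := by
  rw [← IntermediateField.mem_toSubalgebra, biquadraticField,
    IntermediateField.adjoin_toSubalgebra_of_isAlgebraic (by
      rintro y (rfl | rfl | rfl) <;> exact (isIntegral_sqrt_natCast _).isAlgebraic)] at hx
  induction hx using Algebra.adjoin_induction with
  | mem x hx =>
    obtain rfl | rfl | rfl := hx
    · exact ⟨0, 1, 0, 0, by simp⟩
    · exact ⟨0, 0, 1, 0, by simp⟩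
    · exact ⟨0, 0, 0, 1, by simp⟩
  | algebraMap q => exact ⟨q, 0, 0, 0, by simp⟩
  | add x y _ _ hx hy =>
    obtain ⟨a, b, c, d, rfl⟩ := hx
    obtain ⟨a', b', c', d', rfl⟩ := hy
    exact ⟨a + a', b + b', c + c', d + d', by push_cast; ring⟩
  | mul x y _ _ hx hy =>
    obtain ⟨a, b, c, d, rfl⟩ := hx
    obtain ⟨a', b', c', d', rfl⟩ := hy
    refine ⟨a * a' + b * b' * (u * v) + c * c' * (u * w) + d * d' * (v * w),
      a * b' + a' * b + (c * d' + d * c') * w, a * c' + a' * c + (b * d' + d * b') * v,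
      a * d' + a' * d + (b * c' + c * b') * u, ?_⟩
    rw [(isSqrtTriple_sqrt u v w).mul_formula]
    simp only [Rat.cast_add, Rat.cast_mul, Rat.cast_natCast]

theorem exists_biquadraticFrame {u v w : ℕ} (hsq : Squarefree (u * v * w)) (huv : u ≠ v)
    (huw : u ≠ w) (hvw : v ≠ w) :
    ∃ r s t : biquadraticField u v w, BiquadraticFrame u v w r s t := by
  have hirr {m n : ℕ} (hmn : m ≠ n) (hdvd : m * n ∣ u * v * w) :
      Irrational √((m * n : ℕ) : ℝ) :=
    irrational_sqrt_of_squarefree (hsq.squarefree_of_dvd hdvd) fun h ↦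
      hmn ((Nat.eq_one_of_mul_eq_one_right h).trans (Nat.eq_one_of_mul_eq_one_left h).symm)
  have hmem {x : ℝ} (hx : x ∈ ({√((u * v : ℕ) : ℝ), √((u * w : ℕ) : ℝ),
      √((v * w : ℕ) : ℝ)} : Set ℝ)) : x ∈ biquadraticField u v w :=
    IntermediateField.subset_adjoin _ _ hx
  have hR := isSqrtTriple_sqrt u v w
  refine ⟨⟨_, hmem (by simp)⟩, ⟨_, hmem (by simp)⟩, ⟨_, hmem (by simp)⟩,
    ⟨Subtype.ext hR.mul_rs, Subtype.ext hR.mul_rt, Subtype.ext hR.mul_st, Subtype.ext hR.sq_r,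
      Subtype.ext hR.sq_s, Subtype.ext hR.sq_t⟩, fun a b c d h0 ↦ ?_, fun x ↦ ?_⟩
  · have hu : u ≠ 0 := left_ne_zero_of_mul (left_ne_zero_of_mul hsq.ne_zero)
    exact hR.eq_zero_of_add_eq_zero hu (hirr huv ⟨w, rfl⟩) (hirr huw ⟨v, by ring⟩)
      (hirr hvw ⟨u, by ring⟩) (by simpa using congrArg Subtype.val h0)
  · obtain ⟨a, b, c, d, hx⟩ := exists_coords_of_mem_biquadraticField x.2
    exact ⟨a, b, c, d, Subtype.ext (by simpa using hx)⟩

theorem eq_mul_of_sqrt_mem_biquadraticField {u v w n : ℕ} (hsq : Squarefree (u * v * w))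
    (huv : u ≠ v) (huw : u ≠ w) (hvw : v ≠ w) (hn : Squarefree n) (hn1 : n ≠ 1)
    (hmem : √(n : ℝ) ∈ biquadraticField u v w) : n = u * v ∨ n = u * w ∨ n = v * w := by
  obtain ⟨r, s, t, h⟩ := exists_biquadraticFrame hsq huv huw hvw
  refine h.eq_mul_of_sq_eq (hsq.squarefree_of_dvd ⟨w, rfl⟩) (hsq.squarefree_of_dvd ⟨v, by ring⟩)
    (hsq.squarefree_of_dvd ⟨u, by ring⟩) hn hn1 (x := ⟨_, hmem⟩) (Subtype.ext ?_)
  simp [Real.sq_sqrt]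

theorem biquadraticField_eq_adjoin {u v w : ℕ} (hu : u ≠ 0) : biquadraticField u v w =
    IntermediateField.adjoin ℚ {√((u * v : ℕ) : ℝ), √((u * w : ℕ) : ℝ)} := by
  refine le_antisymm (IntermediateField.adjoin_le_iff.mpr ?_)
    (IntermediateField.adjoin.mono _ _ _ (by grind))
  set L := IntermediateField.adjoin ℚ {√((u * v : ℕ) : ℝ), √((u * w : ℕ) : ℝ)}
  have hr : √((u * v : ℕ) : ℝ) ∈ L := IntermediateField.subset_adjoin _ _ (by simp)
  have hs : √((u * w : ℕ) : ℝ) ∈ L := IntermediateField.subset_adjoin _ _ (by simp)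
  have ht : √((v * w : ℕ) : ℝ) ∈ L := by
    rw [eq_div_of_mul_eq (Nat.cast_ne_zero.mpr hu)
      ((mul_comm _ _).trans (sqrt_mul_sqrt_common u v w).symm)]
    exact div_mem (mul_mem hr hs) (natCast_mem L u)
  rintro x (rfl | rfl | rfl) <;> assumption

theorem finrank_adjoin_sqrt_le (n : ℕ) :
    Module.finrank ℚ (IntermediateField.adjoin ℚ {√(n : ℝ)}) ≤ 2 := by
  rw [IntermediateField.adjoin.finrank (isIntegral_sqrt_natCast n),
    ← Polynomial.natDegree_X_pow_sub_C (n := 2) (r := (n : ℚ))]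
  refine Polynomial.natDegree_le_of_dvd (minpoly.dvd _ _ ?_)
    (Polynomial.X_pow_sub_C_ne_zero two_pos _)
  simp [Real.sq_sqrt]

theorem finrank_adjoin_one_sqrt_le (n : ℕ) :
    Module.finrank ℚ (IntermediateField.adjoin ℚ {√((1 : ℕ) : ℝ), √(n : ℝ)}) ≤ 2 := by
  have hadjoin : IntermediateField.adjoin ℚ {√((1 : ℕ) : ℝ), √(n : ℝ)} =
      IntermediateField.adjoin ℚ {√(n : ℝ)} := by
    rw [Nat.cast_one, Real.sqrt_one]
    refine le_antisymm (IntermediateField.adjoin_le_iff.mpr ?_)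
      (IntermediateField.adjoin.mono _ _ _ (by simp))
    rintro x (rfl | rfl)
    · exact one_mem _
    · exact IntermediateField.subset_adjoin _ _ rfl
  rw [hadjoin]
  exact finrank_adjoin_sqrt_le n

end RealFields

/-- The increasing triples with odd squarefree product; they parametrise the fields of the
family. -/
def sortedTriples : Set (ℕ × ℕ × ℕ) :=
  {p | p.1 < p.2.1 ∧ p.2.1 < p.2.2 ∧ Odd (p.1 * p.2.1 * p.2.2) ∧
    Squarefree (p.1 * p.2.1 * p.2.2)}

section Parametrisation

variable {u v w : ℕ}

theorem biquadraticField_mem (h : (u, v, w) ∈ sortedTriples) :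
    biquadraticField u v w ∈ oddRealBiquadraticFields := by
  obtain ⟨huv, hvw, hodd, hsq⟩ := h
  obtain ⟨r, s, t, hframe⟩ := exists_biquadraticFrame hsq huv.ne (huv.trans hvw).ne hvw.ne
  have hodd' : Odd (u * w * v) := by rwa [mul_right_comm]
  exact ⟨hframe.finrank_eq, u * v, u * w, Nat.Odd.of_mul_left hodd, Nat.Odd.of_mul_left hodd',
    hsq.squarefree_of_dvd ⟨w, rfl⟩, hsq.squarefree_of_dvd ⟨v, by ring⟩,
    biquadraticField_eq_adjoin (left_ne_zero_of_mul (left_ne_zero_of_mul hsq.ne_zero))⟩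

theorem abs_discr_biquadraticField [NumberField (biquadraticField u v w)]
    (h : (u, v, w) ∈ sortedTriples) :
    |NumberField.discr (biquadraticField u v w)| = tripleDiscr (u, v, w) := by
  obtain ⟨huv, hvw, hodd, hsq⟩ := h
  obtain ⟨r, s, t, hframe⟩ := exists_biquadraticFrame hsq huv.ne (huv.trans hvw).ne hvw.ne
  rw [hframe.discr_eq hodd hsq, Nat.abs_cast]

theorem mul_lt_mul_lt_mul_of_mem_sortedTriples (h : (u, v, w) ∈ sortedTriples) :
    1 < u * v ∧ u * v < u * w ∧ u * w < v * w := by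
  obtain ⟨huv, hvw, -, hsq⟩ := h
  have hu : 0 < u := Nat.pos_of_ne_zero (left_ne_zero_of_mul (left_ne_zero_of_mul hsq.ne_zero))
  simp only at huv hvw
  exact ⟨by nlinarith, Nat.mul_lt_mul_of_pos_left hvw hu,
    Nat.mul_lt_mul_of_pos_right huv (by omega)⟩

theorem eq_of_pairwise_mul_eq_mul {u' v' w' : ℕ} (hu : u ≠ 0) (hvw : v * w ≠ 0)
    (huv' : u' * v' = u * v) (huw' : u' * w' = u * w) (hvw' : v' * w' = v * w) :
    u' = u ∧ v' = v ∧ w' = w := by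
  have hsq : u' ^ 2 * (v * w) = u ^ 2 * (v * w) := by
    calc u' ^ 2 * (v * w) = u' * v' * (u' * w') := by rw [← hvw']; ring
      _ = u ^ 2 * (v * w) := by rw [huv', huw']; ring
  obtain rfl : u' = u :=
    Nat.pow_left_injective two_ne_zero (Nat.eq_of_mul_eq_mul_right (Nat.pos_of_ne_zero hvw) hsq)
  exact ⟨rfl, mul_left_cancel₀ hu huv', mul_left_cancel₀ hu huw'⟩

/-- The field determines `{uv, uw, vw}`, the set of squarefree integers `n > 1` whose square root it
contains, and the order of `u`, `v`, `w` then tells these products apart. -/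
theorem biquadraticField_injOn :
    Set.InjOn (fun p : ℕ × ℕ × ℕ ↦ biquadraticField p.1 p.2.1 p.2.2) sortedTriples := by
  rintro ⟨u, v, w⟩ hp ⟨u', v', w'⟩ hp' heq
  obtain ⟨huv, hvw, -, hsq⟩ := id hp
  obtain ⟨-, -, -, hsq'⟩ := id hp'
  simp only at huv hvw hsq hsq' heq
  obtain ⟨h_one_lt, h_uv_lt, h_uw_lt⟩ := mul_lt_mul_lt_mul_of_mem_sortedTriples hp
  obtain ⟨h_one_lt', h_uv_lt', h_uw_lt'⟩ := mul_lt_mul_lt_mul_of_mem_sortedTriples hp'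
  have hgen {n : ℕ} (hn : n ∣ u' * v' * w') (hn1 : 1 < n) (hroot : √(n : ℝ) ∈
      ({√((u' * v' : ℕ) : ℝ), √((u' * w' : ℕ) : ℝ), √((v' * w' : ℕ) : ℝ)} : Set ℝ)) :
      n = u * v ∨ n = u * w ∨ n = v * w :=
    eq_mul_of_sqrt_mem_biquadraticField hsq huv.ne (huv.trans hvw).ne hvw.ne
      (hsq'.squarefree_of_dvd hn) hn1.ne' (heq ▸ IntermediateField.subset_adjoin _ _ hroot)
  have huv_cases := hgen (n := u' * v') ⟨w', rfl⟩ h_one_lt' (by simp)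
  have huw_cases := hgen (n := u' * w') ⟨v', by ring⟩ (by omega) (by simp)
  have hvw_cases := hgen (n := v' * w') ⟨u', by ring⟩ (by omega) (by simp)
  have huv_eq : u' * v' = u * v := by omega
  have huw_eq : u' * w' = u * w := by omega
  have hvw_eq : v' * w' = v * w := by omega
  obtain ⟨rfl, rfl, rfl⟩ := eq_of_pairwise_mul_eq_mul
    (left_ne_zero_of_mul (left_ne_zero_of_mul hsq.ne_zero)) (by omega) huv_eq huw_eq hvw_eq
  rfl

theorem exists_mem_sortedTriples_of_ne (huv : u ≠ v) (huw : u ≠ w) (hvw : v ≠ w)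
    (hodd : Odd (u * v * w)) (hsq : Squarefree (u * v * w)) :
    ∃ p ∈ sortedTriples, biquadraticField p.1 p.2.1 p.2.2 = biquadraticField u v w := by
  wlog hlt : u < v generalizing u v
  · obtain ⟨p, hp, hpe⟩ := this huv.symm hvw huw (by rwa [mul_comm v u])
      (by rwa [mul_comm v u]) (by omega)
    exact ⟨p, hp, by rw [hpe, biquadraticField_swap_left]⟩
  obtain hvw_lt | hwv_lt := lt_or_gt_of_ne hvw
  · exact ⟨(u, v, w), ⟨hlt, hvw_lt, hodd, hsq⟩, rfl⟩
  obtain huw_lt | hwu_lt := lt_or_gt_of_ne huw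
  · have hperm : u * w * v = u * v * w := by ring
    exact ⟨(u, w, v), ⟨huw_lt, hwv_lt, by rwa [hperm], by rwa [hperm]⟩,
      biquadraticField_swap_right u v w⟩
  · have hperm : w * u * v = u * v * w := by ring
    exact ⟨(w, u, v), ⟨hwu_lt, hlt, by rwa [hperm], by rwa [hperm]⟩, by
      rw [biquadraticField_swap_left, biquadraticField_swap_right]⟩

theorem pairwise_ne_of_finrank_eq_four {g : ℕ} (hgv : g.Coprime v) (hgw : g.Coprime w)
    (hrank : Module.finrank ℚ
      (IntermediateField.adjoin ℚ {√((g * v : ℕ) : ℝ), √((g * w : ℕ) : ℝ)}) = 4) :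
    g ≠ v ∧ g ≠ w ∧ v ≠ w := by
  refine ⟨?_, ?_, ?_⟩
  · rintro rfl
    obtain rfl := (Nat.coprime_self g).mp hgv
    linarith [finrank_adjoin_one_sqrt_le (1 * w)]
  · rintro rfl
    obtain rfl := (Nat.coprime_self g).mp hgw
    rw [Set.pair_comm] at hrank
    linarith [finrank_adjoin_one_sqrt_le (1 * v)]
  · rintro rfl
    rw [Set.pair_eq_singleton] at hrank
    linarith [finrank_adjoin_sqrt_le (g * v)]

/-- Write `a = g v` and `b = g w` with `g = gcd a b`. -/
theorem exists_mem_sortedTriples_of_mem {K : IntermediateField ℚ ℝ}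
    (hK : K ∈ oddRealBiquadraticFields) :
    ∃ p ∈ sortedTriples, biquadraticField p.1 p.2.1 p.2.2 = K := by
  obtain ⟨hrank, a, b, ha, hb, hsa, hsb, rfl⟩ := hK
  obtain ⟨v, w, hvw, ha_eq, hb_eq⟩ := Nat.exists_coprime a b
  generalize a.gcd b = g at ha_eq hb_eq
  obtain rfl : a = g * v := ha_eq.trans (mul_comm v g)
  obtain rfl : b = g * w := hb_eq.trans (mul_comm w g)
  obtain ⟨hgv, -, -⟩ := Nat.squarefree_mul_iff.mp hsa
  obtain ⟨hgw, -, hsw⟩ := Nat.squarefree_mul_iff.mp hsb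
  obtain ⟨hgv_ne, hgw_ne, hvw_ne⟩ := pairwise_ne_of_finrank_eq_four hgv hgw hrank
  obtain ⟨p, hp, hpK⟩ := exists_mem_sortedTriples_of_ne hgv_ne hgw_ne hvw_ne
    (ha.mul (Nat.Odd.of_mul_right hb))
    (Nat.squarefree_mul_iff.mpr ⟨Nat.Coprime.mul_left hgw hvw, hsa, hsw⟩)
  exact ⟨p, hp, by rw [hpK, biquadraticField_eq_adjoin (left_ne_zero_of_mul hsa.ne_zero)]⟩

theorem oddRealBiquadraticFieldsUpTo_eq_image (X : ℝ) :
    oddRealBiquadraticFieldsUpTo X = (fun p : ℕ × ℕ × ℕ ↦ biquadraticField p.1 p.2.1 p.2.2) ''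
      {p ∈ sortedTriples | (tripleDiscr p : ℝ) ≤ X} := by
  ext K
  constructor
  · rintro ⟨hK, hN, hd⟩
    obtain ⟨p, hp, rfl⟩ := exists_mem_sortedTriples_of_mem hK
    rw [abs_discr_biquadraticField hp] at hd
    exact ⟨p, ⟨hp, by exact_mod_cast hd⟩, rfl⟩
  · rintro ⟨p, ⟨hp, hX⟩, rfl⟩
    have hK := biquadraticField_mem hp
    have : FiniteDimensional ℚ (biquadraticField p.1 p.2.1 p.2.2) :=
      FiniteDimensional.of_finrank_pos (by rw [hK.1]; norm_num)
    have hN : NumberField (biquadraticField p.1 p.2.1 p.2.2) := ⟨⟩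
    refine ⟨hK, hN, ?_⟩
    rw [abs_discr_biquadraticField hp]
    exact_mod_cast hX

end Parametrisation

/-! ### The correction series -/

section LocalFactors

open ArithmeticFunction
open scoped ArithmeticFunction.Moebius ArithmeticFunction.zeta

theorem pmul_mul_of_map_mul {R : Type*} [CommSemiring R] {c : ArithmeticFunction R}
    (hc : ∀ m n, c (m * n) = c m * c n) (f g : ArithmeticFunction R) :
    c.pmul (f * g) = c.pmul f * c.pmul g := by
  ext n
  simp only [pmul_apply, mul_apply, Finset.mul_sum]
  refine Finset.sum_congr rfl fun x hx ↦ ?_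
  rw [← (Nat.mem_divisorsAntidiagonal.mp hx).1, hc]
  ring

theorem mul_apply_prime_pow_succ_of_eq_zero {R : Type*} [Semiring R] (f g : ArithmeticFunction R)
    {p : ℕ} (hp : p.Prime) (hg : ∀ k, g (p ^ (k + 2)) = 0) (k : ℕ) :
    (f * g) (p ^ (k + 1)) = f (p ^ k) * g p + f (p ^ (k + 1)) * g 1 := by
  have hdiv {i j : ℕ} (h : i ≤ j) : p ^ j / p ^ i = p ^ (j - i) := Nat.pow_div h hp.pos
  rw [mul_apply, Nat.sum_divisorsAntidiagonal (fun a b ↦ f a * g b), Nat.divisors_prime_pow hp,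
    Finset.sum_map, Finset.sum_range_succ, Finset.sum_range_succ]
  simp only [Function.Embedding.coeFn_mk]
  rw [Finset.sum_eq_zero, hdiv k.le_succ, hdiv le_rfl]
  · simp
  · intro i hi
    rw [Finset.mem_range] at hi
    rw [hdiv (by omega), show k + 1 - i = k - i - 1 + 2 by omega, hg, mul_zero]

theorem mul_pmul_moebius_apply_prime_pow_succ {R : Type*} [Ring R] {c : ArithmeticFunction R}
    (hc : c 1 = 1) (f : ArithmeticFunction R) {p : ℕ} (hp : p.Prime) (k : ℕ) :
    (f * c.pmul μ) (p ^ (k + 1)) = f (p ^ (k + 1)) - f (p ^ k) * c p := by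
  have hvanish (k : ℕ) : c.pmul μ (p ^ (k + 2)) = 0 := by
    simp [moebius_apply_prime_pow hp]
  rw [mul_apply_prime_pow_succ_of_eq_zero f _ hp hvanish]
  simp only [pmul_apply, intCoe_apply, moebius_apply_prime hp, moebius_apply_one, hc,
    Int.cast_neg, Int.cast_one, mul_neg, mul_one]
  abel

theorem mul_pmul_moebius_apply_one {R : Type*} [Ring R] {c : ArithmeticFunction R}
    (hc : c 1 = 1) (f : ArithmeticFunction R) : (f * c.pmul μ) 1 = f 1 := by
  simp [hc]

theorem hasSum_mul_pmul_moebius_prime_pow {c f : ArithmeticFunction ℝ} (hc : c 1 = 1) {p : ℕ}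
    (hp : p.Prime) {x A : ℝ} (hf : HasSum (fun k ↦ f (p ^ k) * x ^ k) A) :
    HasSum (fun k ↦ (f * c.pmul μ) (p ^ k) * x ^ k) (A * (1 - c p * x)) := by
  have htail := (hasSum_nat_add_iff' 1).mpr hf
  rw [← hasSum_nat_add_iff' 1]
  simp only [Finset.range_one, Finset.sum_singleton, pow_zero, mul_one,
    mul_pmul_moebius_apply_one hc] at htail ⊢
  rw [show A * (1 - c p * x) - f 1 = A - f 1 - A * (c p * x) by ring]
  refine (htail.sub (hf.mul_right (c p * x))).congr_fun fun k ↦ ?_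
  rw [mul_pmul_moebius_apply_prime_pow_succ hc f hp]
  ring

theorem abs_mul_pmul_moebius_prime_pow_le {c f : ArithmeticFunction ℝ} (hc : c 1 = 1) {p : ℕ}
    (hp : p.Prime) (hcp : |c p| ≤ 1) {B : ℝ} (hf : ∀ k, |f (p ^ k)| ≤ B) (k : ℕ) :
    |(f * c.pmul μ) (p ^ k)| ≤ 2 * B := by
  have hB : 0 ≤ B := (abs_nonneg _).trans (hf 0)
  rcases k with _ | k
  · rw [pow_zero, mul_pmul_moebius_apply_one hc]
    linarith [pow_zero p ▸ hf 0]
  · rw [mul_pmul_moebius_apply_prime_pow_succ hc f hp]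
    calc |f (p ^ (k + 1)) - f (p ^ k) * c p|
        ≤ |f (p ^ (k + 1))| + |f (p ^ k) * c p| := abs_sub _ _
      _ ≤ B + B * 1 := by
        rw [abs_mul]
        exact add_le_add (hf _) (mul_le_mul (hf k) hcp (abs_nonneg _) hB)
      _ = 2 * B := by ring

/-- A completely multiplicative real function bounded by `1` in absolute value. -/
structure IsBoundedCharacter (c : ArithmeticFunction ℝ) : Prop where
  map_one : c 1 = 1
  map_mul : ∀ m n, c (m * n) = c m * c n
  abs_le : ∀ n, |c n| ≤ 1

namespace IsBoundedCharacter

theorem isMultiplicative {c : ArithmeticFunction ℝ} (hc : IsBoundedCharacter c) :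
    c.IsMultiplicative :=
  ⟨hc.map_one, fun _ ↦ hc.map_mul _ _⟩

theorem isMultiplicative_pmul_moebius {c : ArithmeticFunction ℝ} (hc : IsBoundedCharacter c) :
    (c.pmul μ).IsMultiplicative :=
  hc.isMultiplicative.pmul isMultiplicative_moebius.intCast

theorem pmul_moebius_mul_self {c : ArithmeticFunction ℝ} (hc : IsBoundedCharacter c) :
    c.pmul μ * c = 1 := by
  have hpmul := pmul_mul_of_map_mul hc.map_mul μ ζ
  rw [coe_moebius_mul_coe_zeta, pmul_zeta] at hpmul
  rw [← hpmul]
  ext n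
  rw [pmul_apply, one_apply]
  split_ifs with hn
  · rw [hn, hc.map_one, one_mul]
  · rw [mul_zero]

end IsBoundedCharacter

theorem isBoundedCharacter_zeta : IsBoundedCharacter ζ where
  map_one := by simp
  map_mul m n := by
    by_cases hm : m = 0 <;> by_cases hn : n = 0 <;> simp [hm, hn]
  abs_le n := by
    by_cases hn : n = 0 <;> simp [hn]

/-- The indicator function of the odd squarefree numbers. -/
noncomputable def oddSquarefree : ArithmeticFunction ℝ :=
  ⟨fun n ↦ if Odd n ∧ Squarefree n then 1 else 0, by simp⟩

theorem oddSquarefree_apply (n : ℕ) :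
    oddSquarefree n = if Odd n ∧ Squarefree n then 1 else 0 := rfl

theorem isMultiplicative_oddSquarefree : oddSquarefree.IsMultiplicative := by
  refine ⟨by simp [oddSquarefree_apply], fun {m n} hmn ↦ ?_⟩
  simp only [oddSquarefree_apply, Nat.odd_mul, Nat.squarefree_mul_iff,
    ite_zero_mul_ite_zero, mul_one]
  exact if_congr (by tauto) rfl rfl

theorem oddSquarefree_two : oddSquarefree 2 = 0 :=
  (oddSquarefree_apply 2).trans (if_neg fun h ↦ absurd h.1 (by decide))

theorem oddSquarefree_prime {p : ℕ} (hp : p.Prime) (hp2 : p ≠ 2) : oddSquarefree p = 1 :=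
  (oddSquarefree_apply p).trans <| if_pos ⟨hp.odd_of_ne_two hp2, hp.prime.squarefree⟩

theorem oddSquarefree_prime_pow_add_two {p : ℕ} (hp : p.Prime) (k : ℕ) :
    oddSquarefree (p ^ (k + 2)) = 0 :=
  (oddSquarefree_apply _).trans <|
    if_neg fun h ↦ hp.ne_one (Nat.isUnit_iff.mp (h.2 p ⟨p ^ k, by ring⟩))

/-- The sum of `f u * g v * h w` over the factorisations `n = u * v * w`, for `n` odd and
squarefree, and `0` for all other `n`. -/
noncomputable def weightedTriples (f g h : ArithmeticFunction ℝ) : ArithmeticFunction ℝ :=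
  oddSquarefree.pmul (f * g * h)

/-- The quotient of `weightedTriples f g h` by `f * g * h` for Dirichlet convolution, when `f`, `g`
and `h` are completely multiplicative. -/
noncomputable def correction (f g h : ArithmeticFunction ℝ) : ArithmeticFunction ℝ :=
  weightedTriples f g h * f.pmul μ * g.pmul μ * h.pmul μ

variable {f g h : ArithmeticFunction ℝ}

theorem correction_mul_mul_mul (hf : IsBoundedCharacter f) (hg : IsBoundedCharacter g)
    (hh : IsBoundedCharacter h) : correction f g h * (f * g * h) = weightedTriples f g h := by
  calc correction f g h * (f * g * h)
      = weightedTriples f g h * (f.pmul μ * f) * (g.pmul μ * g) * (h.pmul μ * h) := by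
        rw [correction]
        ring
    _ = weightedTriples f g h := by
        rw [hf.pmul_moebius_mul_self, hg.pmul_moebius_mul_self, hh.pmul_moebius_mul_self]
        simp only [mul_one]

theorem isMultiplicative_weightedTriples (hf : IsBoundedCharacter f) (hg : IsBoundedCharacter g)
    (hh : IsBoundedCharacter h) : (weightedTriples f g h).IsMultiplicative :=
  isMultiplicative_oddSquarefree.pmul
    ((hf.isMultiplicative.mul hg.isMultiplicative).mul hh.isMultiplicative)

theorem isMultiplicative_correction (hf : IsBoundedCharacter f) (hg : IsBoundedCharacter g)
    (hh : IsBoundedCharacter h) : (correction f g h).IsMultiplicative :=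
  (((isMultiplicative_weightedTriples hf hg hh).mul hf.isMultiplicative_pmul_moebius).mul
    hg.isMultiplicative_pmul_moebius).mul hh.isMultiplicative_pmul_moebius

theorem weightedTriples_prime (hf : f 1 = 1) (hg : g 1 = 1) (hh : h 1 = 1) {p : ℕ}
    (hp : p.Prime) : weightedTriples f g h p = oddSquarefree p * (f p + g p + h p) := by
  have hmul (a b : ArithmeticFunction ℝ) : (a * b) p = a 1 * b p + a p * b 1 := by
    rw [mul_apply, Nat.sum_divisorsAntidiagonal (fun i j ↦ a i * b j), hp.sum_divisors,
      Nat.div_self hp.pos, Nat.div_one, add_comm]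
  rw [weightedTriples, pmul_apply, hmul, hmul, mul_apply_one, hf, hg, hh]
  ring

theorem weightedTriples_prime_pow_add_two {p : ℕ} (hp : p.Prime) (k : ℕ) :
    weightedTriples f g h (p ^ (k + 2)) = 0 := by
  rw [weightedTriples, pmul_apply, oddSquarefree_prime_pow_add_two hp, zero_mul]

theorem abs_weightedTriples_prime_pow_le (hf : IsBoundedCharacter f) (hg : IsBoundedCharacter g)
    (hh : IsBoundedCharacter h) {p : ℕ} (hp : p.Prime) (k : ℕ) :
    |weightedTriples f g h (p ^ k)| ≤ 3 := by
  match k with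
  | 0 => simp [(isMultiplicative_weightedTriples hf hg hh).map_one]
  | 1 =>
    rw [pow_one, weightedTriples_prime hf.map_one hg.map_one hh.map_one hp, oddSquarefree_apply]
    have hsum : |f p + g p + h p| ≤ 3 := by
      linarith [abs_add_three (f p) (g p) (h p), hf.abs_le p, hg.abs_le p, hh.abs_le p]
    split_ifs <;> simp [hsum]
  | k + 2 => simp [weightedTriples_prime_pow_add_two hp]

theorem hasSum_weightedTriples_prime_pow (hf : IsBoundedCharacter f) (hg : IsBoundedCharacter g)
    (hh : IsBoundedCharacter h) {p : ℕ} (hp : p.Prime) (x : ℝ) :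
    HasSum (fun k ↦ weightedTriples f g h (p ^ k) * x ^ k)
      (1 + oddSquarefree p * (f p + g p + h p) * x) := by
  rw [← hasSum_nat_add_iff' 2]
  simp [Finset.sum_range_succ, (isMultiplicative_weightedTriples hf hg hh).map_one,
    weightedTriples_prime hf.map_one hg.map_one hh.map_one hp,
    weightedTriples_prime_pow_add_two hp, hasSum_zero]

theorem hasSum_correction_prime_pow (hf : IsBoundedCharacter f) (hg : IsBoundedCharacter g)
    (hh : IsBoundedCharacter h) {p : ℕ} (hp : p.Prime) (x : ℝ) :
    HasSum (fun k ↦ correction f g h (p ^ k) * x ^ k)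
      ((1 + oddSquarefree p * (f p + g p + h p) * x) *
        (1 - f p * x) * (1 - g p * x) * (1 - h p * x)) :=
  hasSum_mul_pmul_moebius_prime_pow hh.map_one hp <|
    hasSum_mul_pmul_moebius_prime_pow hg.map_one hp <|
    hasSum_mul_pmul_moebius_prime_pow hf.map_one hp <|
    hasSum_weightedTriples_prime_pow hf hg hh hp x

theorem abs_correction_prime_pow_le (hf : IsBoundedCharacter f) (hg : IsBoundedCharacter g)
    (hh : IsBoundedCharacter h) {p : ℕ} (hp : p.Prime) (k : ℕ) :
    |correction f g h (p ^ k)| ≤ 24 :=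
  (abs_mul_pmul_moebius_prime_pow_le hh.map_one hp (hh.abs_le p)
    (abs_mul_pmul_moebius_prime_pow_le hg.map_one hp (hg.abs_le p)
    (abs_mul_pmul_moebius_prime_pow_le hf.map_one hp (hf.abs_le p)
    (abs_weightedTriples_prime_pow_le hf hg hh hp))) k).trans_eq (by norm_num)

theorem correction_prime_eq_zero (hf : IsBoundedCharacter f) (hg : IsBoundedCharacter g)
    (hh : IsBoundedCharacter h) {p : ℕ} (hp : p.Prime) (hp2 : p ≠ 2) :
    correction f g h p = 0 := by
  have hstep {c : ArithmeticFunction ℝ} (hc : IsBoundedCharacter c) (F : ArithmeticFunction ℝ)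
      (hF : F 1 = 1) : (F * c.pmul μ) p = F p - c p := by
    simpa [hF] using mul_pmul_moebius_apply_prime_pow_succ hc.map_one F hp 0
  have hw := isMultiplicative_weightedTriples hf hg hh
  have hwf := hw.mul hf.isMultiplicative_pmul_moebius
  have hwfg := hwf.mul hg.isMultiplicative_pmul_moebius
  rw [correction, hstep hh _ hwfg.map_one, hstep hg _ hwf.map_one, hstep hf _ hw.map_one,
    weightedTriples_prime hf.map_one hg.map_one hh.map_one hp, oddSquarefree_prime hp hp2]
  ring

end LocalFactors

section CorrectionSeries

open ArithmeticFunction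
open scoped ArithmeticFunction.zeta

theorem summable_of_tsum_prime_pow_le {f : ℕ → ℝ} (hf : ∀ n, 0 ≤ f n) (hf₀ : f 0 = 0)
    (hf₁ : f 1 = 1) (hmul : ∀ {m n}, Nat.Coprime m n → f (m * n) = f m * f n) {b : ℕ → ℝ}
    (hb : ∀ n, 0 ≤ b n) (hb_sum : Summable b)
    (hsum : ∀ {p : ℕ}, p.Prime → Summable fun k ↦ f (p ^ k))
    (hle : ∀ {p : ℕ}, p.Prime → ∑' k, f (p ^ k) ≤ 1 + b p) : Summable f := by
  refine summable_of_sum_le (c := Real.exp (∑' n, b n)) hf fun s ↦ ?_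
  set N := s.sup id + 1
  have hsmooth := hasSum_subtype_iff_indicator.mp
    (show HasSum (f ∘ ((↑) : N.smoothNumbers → ℕ)) _ from
      (EulerProduct.summable_and_hasSum_smoothNumbers_prod_primesBelow_tsum hf₁ hmul
        (fun hp ↦ by simpa [Real.norm_eq_abs, abs_of_nonneg (hf _)] using hsum hp) N).2)
  have hind (n : ℕ) : 0 ≤ N.smoothNumbers.indicator f n := Set.indicator_nonneg (fun _ _ ↦ hf _) n
  calc ∑ n ∈ s, f n ≤ ∑ n ∈ s, N.smoothNumbers.indicator f n := by
        refine Finset.sum_le_sum fun n hn ↦ ?_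
        rcases Nat.eq_zero_or_pos n with rfl | hpos
        · exact hf₀.trans_le (hind 0)
        · have hlt : n < N := Nat.lt_succ_of_le (Finset.le_sup (f := id) hn)
          rw [Set.indicator_of_mem (Nat.mem_smoothNumbers_of_lt hpos hlt)]
    _ ≤ ∏ p ∈ N.primesBelow, ∑' k, f (p ^ k) := sum_le_hasSum s (fun n _ ↦ hind n) hsmooth
    _ ≤ ∏ p ∈ N.primesBelow, Real.exp (b p) := by
        refine Finset.prod_le_prod (fun p _ ↦ tsum_nonneg fun k ↦ hf _) fun p hp ↦ ?_
        linarith [hle (Nat.prime_of_mem_primesBelow hp), Real.add_one_le_exp (b p)]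
    _ = Real.exp (∑ p ∈ N.primesBelow, b p) := (Real.exp_sum _ _).symm
    _ ≤ Real.exp (∑' n, b n) := Real.exp_le_exp.mpr (hb_sum.sum_le_tsum _ fun n _ ↦ hb n)

theorem summable_mul_pow_of_le {a : ℕ → ℝ} {B x : ℝ} (ha : ∀ k, 0 ≤ a k) (haB : ∀ k, a k ≤ B)
    (hx : 0 ≤ x) (hx1 : x < 1) : Summable fun k ↦ a k * x ^ k :=
  .of_nonneg_of_le (fun k ↦ mul_nonneg (ha k) (pow_nonneg hx k))
    (fun k ↦ mul_le_mul_of_nonneg_right (haB k) (pow_nonneg hx k))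
    ((summable_geometric_of_lt_one hx hx1).mul_left B)

theorem tsum_mul_pow_le {a : ℕ → ℝ} {B x : ℝ} (ha : ∀ k, 0 ≤ a k) (haB : ∀ k, a k ≤ B)
    (hx : 0 ≤ x) (hx1 : x < 1) :
    ∑' k, a k * x ^ k ≤ a 0 + a 1 * x + B * x ^ 2 / (1 - x) := by
  have hsum := summable_mul_pow_of_le ha haB hx hx1
  have htail : ∑' k, a (k + 2) * x ^ (k + 2) ≤ B * x ^ 2 / (1 - x) := by
    have hgeom := (hasSum_geometric_of_lt_one hx hx1).mul_left (B * x ^ 2)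
    refine (((summable_nat_add_iff 2).mpr hsum).tsum_le_tsum (fun k ↦ ?_)
      hgeom.summable).trans_eq hgeom.tsum_eq
    calc a (k + 2) * x ^ (k + 2) ≤ B * x ^ (k + 2) :=
          mul_le_mul_of_nonneg_right (haB _) (pow_nonneg hx _)
      _ = B * x ^ 2 * x ^ k := by ring
  rw [← hsum.sum_add_tsum_nat_add 2]
  simpa [Finset.sum_range_succ] using htail

theorem rpow_neg_three_quarters_pow_four {x : ℝ} (hx : 0 ≤ x) :
    (x ^ (-(3 / 4 : ℝ))) ^ 4 = (x ^ 3)⁻¹ := by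
  rw [← Real.rpow_mul_natCast hx, ← Real.rpow_natCast, ← Real.rpow_neg hx]
  norm_num

theorem natCast_rpow_neg_three_quarters_lt {n : ℕ} (hn : 2 ≤ n) :
    (n : ℝ) ^ (-(3 / 4 : ℝ)) < 3 / 5 := by
  refine lt_of_pow_lt_pow_left₀ 4 (by norm_num) ?_
  rw [rpow_neg_three_quarters_pow_four n.cast_nonneg]
  have hn3 : (2 : ℝ) ^ 3 ≤ (n : ℝ) ^ 3 := by gcongr; exact_mod_cast hn
  calc ((n : ℝ) ^ 3)⁻¹ ≤ ((2 : ℝ) ^ 3)⁻¹ := inv_anti₀ (by norm_num) hn3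
    _ < (3 / 5) ^ 4 := by norm_num

variable {f g h : ArithmeticFunction ℝ}

theorem abs_correction_prime_mul_rpow_le (hf : IsBoundedCharacter f) (hg : IsBoundedCharacter g)
    (hh : IsBoundedCharacter h) {p : ℕ} (hp : p.Prime) :
    |correction f g h p| * (p : ℝ) ^ (-(3 / 4 : ℝ)) ≤ 48 * ((p : ℝ) ^ (-(3 / 4 : ℝ))) ^ 2 := by
  set x : ℝ := (p : ℝ) ^ (-(3 / 4 : ℝ)) with hx
  have hx0 : 0 ≤ x := by positivity
  by_cases hp2 : p = 2
  · have hx_lower : 1 / 2 < x := by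
      refine lt_of_pow_lt_pow_left₀ 4 hx0 ?_
      rw [hx, rpow_neg_three_quarters_pow_four p.cast_nonneg, hp2]
      norm_num
    have habs : |correction f g h p| ≤ 24 := by
      simpa using abs_correction_prime_pow_le hf hg hh hp 1
    nlinarith [mul_le_mul_of_nonneg_right habs hx0]
  · rw [correction_prime_eq_zero hf hg hh hp hp2, abs_zero, zero_mul]
    positivity

theorem summable_correction_rpow (hf : IsBoundedCharacter f) (hg : IsBoundedCharacter g)
    (hh : IsBoundedCharacter h) :
    Summable fun n : ℕ ↦ |correction f g h n| * (n : ℝ) ^ (-(3 / 4 : ℝ)) := by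
  have hmul := isMultiplicative_correction hf hg hh
  have hpow (p k : ℕ) : ((p ^ k : ℕ) : ℝ) ^ (-(3 / 4 : ℝ)) = ((p : ℝ) ^ (-(3 / 4 : ℝ))) ^ k := by
    rw [Nat.cast_pow, ← Real.rpow_pow_comm p.cast_nonneg]
  have hlt {p : ℕ} (hp : p.Prime) := natCast_rpow_neg_three_quarters_lt hp.two_le
  refine summable_of_tsum_prime_pow_le (b := fun n ↦ 108 * (n : ℝ) ^ (-(3 / 2 : ℝ)))
    (fun n ↦ by positivity) (by simp) (by simp [hmul.map_one]) (fun {m n} hmn ↦ ?_)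
    (fun n ↦ by positivity) ((Real.summable_nat_rpow.mpr (by norm_num)).mul_left 108)
    (fun {p} hp ↦ ?_) (fun {p} hp ↦ ?_)
  · rw [hmul.map_mul_of_coprime hmn, abs_mul, Nat.cast_mul,
      Real.mul_rpow (by positivity) (by positivity)]
    ring
  · simp_rw [hpow]
    exact summable_mul_pow_of_le (fun k ↦ abs_nonneg _)
      (abs_correction_prime_pow_le hf hg hh hp) (by positivity) ((hlt hp).trans (by norm_num))
  · simp_rw [hpow]
    set x : ℝ := (p : ℝ) ^ (-(3 / 4 : ℝ)) with hx
    have hxx : (p : ℝ) ^ (-(3 / 2 : ℝ)) = x ^ 2 := by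
      rw [hx, ← Real.rpow_mul_natCast p.cast_nonneg]
      norm_num
    have hprime := abs_correction_prime_mul_rpow_le hf hg hh hp
    have hgeom : 24 * x ^ 2 / (1 - x) ≤ 60 * x ^ 2 := by
      rw [div_le_iff₀ (by linarith [hlt hp])]
      nlinarith [hlt hp, sq_nonneg x]
    refine (tsum_mul_pow_le (fun k ↦ abs_nonneg _) (abs_correction_prime_pow_le hf hg hh hp)
      (by positivity) ((hlt hp).trans (by norm_num))).trans ?_
    rw [pow_zero, pow_one, hmul.map_one, abs_one, hxx]
    linarith

theorem summable_correction_log (hf : IsBoundedCharacter f) (hg : IsBoundedCharacter g)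
    (hh : IsBoundedCharacter h) :
    Summable fun n : ℕ ↦ |correction f g h n| * (1 + Real.log n) / n := by
  refine Summable.of_nonneg_of_le (fun n ↦ ?_) (fun n ↦ ?_)
    ((summable_correction_rpow hf hg hh).mul_left 5)
  · have := Real.log_natCast_nonneg n
    positivity
  rcases Nat.eq_zero_or_pos n with rfl | hn
  · simp
  have hn1 : (1 : ℝ) ≤ n := by exact_mod_cast hn
  have hlog : Real.log n ≤ (n : ℝ) ^ (1 / 4 : ℝ) / (1 / 4) :=
    Real.log_le_rpow_div n.cast_nonneg (by norm_num)
  have hone : (1 : ℝ) ≤ (n : ℝ) ^ (1 / 4 : ℝ) := Real.one_le_rpow hn1 (by norm_num)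
  have hdiv : (n : ℝ) ^ (1 / 4 : ℝ) / n = (n : ℝ) ^ (-(3 / 4 : ℝ)) := by
    rw [← Real.rpow_sub_one (by positivity)]
    norm_num
  calc |correction f g h n| * (1 + Real.log n) / n
      ≤ |correction f g h n| * (5 * (n : ℝ) ^ (1 / 4 : ℝ)) / n := by
        gcongr
        linarith
    _ = 5 * (|correction f g h n| * (n : ℝ) ^ (-(3 / 4 : ℝ))) := by rw [← hdiv]; ring

theorem summable_norm_div_of_summable_log {a : ℕ → ℝ}
    (ha : Summable fun n : ℕ ↦ |a n| * (1 + Real.log n) / n) :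
    Summable fun n : ℕ ↦ ‖a n / n‖ := by
  refine ha.of_nonneg_of_le (fun n ↦ norm_nonneg _) fun n ↦ ?_
  rw [norm_div, Real.norm_natCast, Real.norm_eq_abs]
  gcongr
  exact le_mul_of_one_le_right (abs_nonneg _) (by linarith [Real.log_natCast_nonneg n])

theorem hasProd_tsum_correction_div (hf : IsBoundedCharacter f) (hg : IsBoundedCharacter g)
    (hh : IsBoundedCharacter h) :
    HasProd (fun p : Nat.Primes ↦
      (1 + oddSquarefree p * (f p + g p + h p) * (p : ℝ)⁻¹) *
        (1 - f p * (p : ℝ)⁻¹) * (1 - g p * (p : ℝ)⁻¹) * (1 - h p * (p : ℝ)⁻¹))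
      (∑' n : ℕ, correction f g h n / n) := by
  have hmul := isMultiplicative_correction hf hg hh
  refine (EulerProduct.eulerProduct_hasProd (f := fun n : ℕ ↦ correction f g h n / n)
    (by simp [hmul.map_one]) (fun {m n} hmn ↦ ?_)
    (summable_norm_div_of_summable_log (summable_correction_log hf hg hh))
    (by simp)).congr_fun fun p ↦ ?_
  · simp only [hmul.map_mul_of_coprime hmn]
    push_cast
    rw [mul_div_mul_comm]
  · rw [← (hasSum_correction_prime_pow hf hg hh p.2 _).tsum_eq]
    simp only [inv_pow, Nat.cast_pow, div_eq_mul_inv]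

theorem hasProd_biquadraticEulerFactor :
    HasProd biquadraticEulerFactor ((∑' n : ℕ, correction ζ ζ ζ n / n) * (5 / 2)) := by
  have hfactor_two : HasProd (fun p : Nat.Primes ↦ if (p : ℕ) = 2 then (5 / 2 : ℝ) else 1)
      (5 / 2) := by
    simpa using hasProd_single (f := fun p : Nat.Primes ↦ if (p : ℕ) = 2 then (5 / 2 : ℝ) else 1)
      ⟨2, Nat.prime_two⟩ (fun p hp ↦ if_neg fun h ↦ hp (Subtype.ext h))
  have hz := isBoundedCharacter_zeta
  refine ((hasProd_tsum_correction_div hz hz hz).mul hfactor_two).congr_fun fun p ↦ ?_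
  have hzeta : (ζ : ArithmeticFunction ℝ) p = 1 := by simp [p.2.ne_zero]
  rw [hzeta, biquadraticEulerFactor]
  by_cases hp2 : (p : ℕ) = 2
  · rw [if_pos hp2, hp2, oddSquarefree_two]
    norm_num
  · rw [if_neg hp2, oddSquarefree_prime p.2 hp2]
    ring

end CorrectionSeries

/-! ### Mean values of convolutions -/

section SummatoryFunctions

open ArithmeticFunction Finset
open scoped ArithmeticFunction.zeta

/-- The summatory function `∑ f n`, over the positive integers `n ≤ y`. -/
noncomputable def summatory (f : ArithmeticFunction ℝ) (y : ℝ) : ℝ := ∑ n ∈ Ioc 0 ⌊y⌋₊, f n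

theorem summatory_mul (f g : ArithmeticFunction ℝ) (y : ℝ) :
    summatory (f * g) y = ∑ m ∈ Ioc 0 ⌊y⌋₊, f m * summatory g (y / m) := by
  rw [summatory, sum_Ioc_mul_eq_sum_sum]
  exact sum_congr rfl fun m _ ↦ by rw [summatory, Nat.floor_div_natCast]

theorem summatory_zeta_mul (f : ArithmeticFunction ℝ) (y : ℝ) :
    summatory (ζ * f) y = ∑ m ∈ Ioc 0 ⌊y⌋₊, summatory f (y / m) := by
  rw [summatory_mul]
  refine sum_congr rfl fun m hm ↦ ?_
  rw [natCoe_apply, zeta_apply_ne (mem_Ioc.mp hm).1.ne', Nat.cast_one, one_mul]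

theorem one_le_and_le_of_mem_Ioc_floor {y : ℝ} {m : ℕ} (hm : m ∈ Ioc 0 ⌊y⌋₊) :
    (1 : ℝ) ≤ m ∧ (m : ℝ) ≤ y := by
  rw [mem_Ioc] at hm
  exact ⟨by exact_mod_cast hm.1, (Nat.le_floor_iff' hm.1.ne').mp hm.2⟩

theorem one_le_div_of_mem_Ioc_floor {y : ℝ} {m : ℕ} (hm : m ∈ Ioc 0 ⌊y⌋₊) : 1 ≤ y / m := by
  obtain ⟨hm1, hmy⟩ := one_le_and_le_of_mem_Ioc_floor hm
  exact (one_le_div₀ (by linarith)).mpr hmy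

theorem log_div_le_log_of_mem_Ioc_floor {y : ℝ} {m : ℕ} (hm : m ∈ Ioc 0 ⌊y⌋₊) :
    Real.log (y / m) ≤ Real.log y := by
  obtain ⟨hm1, hmy⟩ := one_le_and_le_of_mem_Ioc_floor hm
  exact Real.log_le_log (by linarith [one_le_div_of_mem_Ioc_floor hm])
    (div_le_self (by linarith) hm1)

theorem sum_Ioc_floor_inv_eq_harmonic (y : ℝ) :
    ∑ m ∈ Ioc 0 ⌊y⌋₊, (m : ℝ)⁻¹ = (harmonic ⌊y⌋₊ : ℝ) := by
  rw [harmonic_eq_sum_Icc]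
  push_cast
  rfl

theorem log_le_sum_inv {y : ℝ} (hy : 0 ≤ y) : Real.log y ≤ ∑ m ∈ Ioc 0 ⌊y⌋₊, (m : ℝ)⁻¹ :=
  (log_le_harmonic_floor y hy).trans_eq (sum_Ioc_floor_inv_eq_harmonic y).symm

theorem sum_inv_le_one_add_log {y : ℝ} (hy : 1 ≤ y) :
    ∑ m ∈ Ioc 0 ⌊y⌋₊, (m : ℝ)⁻¹ ≤ 1 + Real.log y :=
  (sum_Ioc_floor_inv_eq_harmonic y).trans_le (harmonic_floor_le_one_add_log y hy)

theorem abs_summatory_zeta_mul_zeta_sub_le {y : ℝ} (hy : 1 ≤ y) :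
    |summatory (ζ * ζ) y - y * Real.log y| ≤ y := by
  have hy0 : 0 ≤ y := by linarith
  have hlower := mul_le_mul_of_nonneg_left (log_le_sum_inv hy0) hy0
  have hupper := mul_le_mul_of_nonneg_left (sum_inv_le_one_add_log hy) hy0
  have hsum : summatory (ζ * ζ) y = ∑ m ∈ Ioc 0 ⌊y⌋₊, (⌊y / m⌋₊ : ℝ) := by
    rw [summatory_zeta_mul]
    refine sum_congr rfl fun m _ ↦ ?_
    simp_rw [summatory, natCoe_apply]
    exact_mod_cast sum_Ioc_zeta ⌊y / m⌋₊
  have hfloor_le : summatory (ζ * ζ) y ≤ y * ∑ m ∈ Ioc 0 ⌊y⌋₊, (m : ℝ)⁻¹ := by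
    rw [hsum, mul_sum]
    exact sum_le_sum fun m _ ↦ by
      rw [← div_eq_mul_inv]
      exact Nat.floor_le (by positivity)
  have hle_floor : y * ∑ m ∈ Ioc 0 ⌊y⌋₊, (m : ℝ)⁻¹ - ⌊y⌋₊ ≤ summatory (ζ * ζ) y := by
    rw [hsum, mul_sum, show (⌊y⌋₊ : ℝ) = ∑ _m ∈ Ioc 0 ⌊y⌋₊, (1 : ℝ) by simp, ← sum_sub_distrib]
    exact sum_le_sum fun m _ ↦ by
      rw [← div_eq_mul_inv]
      exact (Nat.sub_one_lt_floor (y / m)).le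
  have hfloor : (⌊y⌋₊ : ℝ) ≤ y := Nat.floor_le hy0
  rw [abs_le]
  constructor <;> linarith

theorem log_div_sub_log_div_succ_bounds {y : ℝ} (hy : 0 < y) {a : ℕ} (ha : 0 < a) :
    ((a : ℝ) + 1)⁻¹ ≤ Real.log (y / a) - Real.log (y / (a + 1)) ∧
      Real.log (y / a) - Real.log (y / (a + 1)) ≤ (a : ℝ)⁻¹ := by
  have ha0 : (0 : ℝ) < a := by exact_mod_cast ha
  have heq : Real.log (y / a) - Real.log (y / (a + 1)) = Real.log (1 + (a : ℝ)⁻¹) := by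
    rw [← Real.log_div (by positivity) (by positivity)]
    congr 1
    field_simp
  have hlower := Real.one_sub_inv_le_log_of_pos (x := 1 + (a : ℝ)⁻¹) (by positivity)
  have hupper := Real.log_le_sub_one_of_pos (x := 1 + (a : ℝ)⁻¹) (by positivity)
  have hinv : 1 - (1 + (a : ℝ)⁻¹)⁻¹ = ((a : ℝ) + 1)⁻¹ := by
    field_simp
    ring
  rw [heq]
  constructor <;> linarith

theorem abs_log_div_div_sub_le {y : ℝ} {a : ℕ} (ha : a ∈ Ioc 0 ⌊y⌋₊) :
    |Real.log (y / a) / a - (Real.log (y / a) ^ 2 / 2 - Real.log (y / (a + 1)) ^ 2 / 2)| ≤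
      (1 + Real.log y) * ((a : ℝ)⁻¹ - ((a : ℝ) + 1)⁻¹) := by
  obtain ⟨ha1, hay⟩ := one_le_and_le_of_mem_Ioc_floor ha
  have ha0 : (0 : ℝ) < a := by linarith
  have hlog_nonneg := Real.log_nonneg (one_le_div_of_mem_Ioc_floor ha)
  have hlog_le := log_div_le_log_of_mem_Ioc_floor ha
  obtain ⟨hlower, hupper⟩ :=
    log_div_sub_log_div_succ_bounds (ha0.trans_le hay) (mem_Ioc.mp ha).1
  set δ := Real.log (y / a) - Real.log (y / (a + 1)) with hδ
  have hδ0 : 0 ≤ δ := le_trans (by positivity) hlower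
  have hδ_sq : δ ^ 2 / 2 ≤ (a : ℝ)⁻¹ - ((a : ℝ) + 1)⁻¹ := by
    calc δ ^ 2 / 2 ≤ (a : ℝ)⁻¹ ^ 2 / 2 := by gcongr
      _ = (a : ℝ)⁻¹ - ((a : ℝ) + 1)⁻¹ - (a - 1) / (2 * a ^ 2 * (a + 1)) := by
        field_simp
        ring
      _ ≤ (a : ℝ)⁻¹ - ((a : ℝ) + 1)⁻¹ := sub_le_self _ (by
        have := sub_nonneg.mpr ha1
        positivity)
  have hsplit : Real.log (y / a) / a -
      (Real.log (y / a) ^ 2 / 2 - Real.log (y / (a + 1)) ^ 2 / 2) =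
      Real.log (y / a) * ((a : ℝ)⁻¹ - δ) + δ ^ 2 / 2 := by
    rw [show Real.log (y / (a + 1)) = Real.log (y / a) - δ by rw [hδ]; ring]
    ring
  have hgap : 0 ≤ (a : ℝ)⁻¹ - δ := sub_nonneg.mpr hupper
  rw [hsplit, abs_of_nonneg (by positivity)]
  have hmain : Real.log (y / a) * ((a : ℝ)⁻¹ - δ) ≤
      Real.log y * ((a : ℝ)⁻¹ - ((a : ℝ) + 1)⁻¹) :=
    mul_le_mul hlog_le (by linarith) hgap (by linarith)
  linarith

theorem abs_sum_Ioc_log_div_div_sub_le {y : ℝ} {N : ℕ} (hN : N ≤ ⌊y⌋₊) :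
    |∑ m ∈ Ioc 0 N, Real.log (y / m) / m -
        (Real.log y ^ 2 / 2 - Real.log (y / (N + 1)) ^ 2 / 2)| ≤
      (1 + Real.log y) * (1 - ((N : ℝ) + 1)⁻¹) := by
  induction N with
  | zero => simp
  | succ N ih =>
    have hstep := abs_log_div_div_sub_le (mem_Ioc.mpr ⟨N.succ_pos, hN⟩)
    rw [sum_Ioc_succ_top N.zero_le]
    push_cast at hstep ⊢
    refine (le_of_eq (congrArg _ ?_)).trans
      ((abs_add_le _ _).trans ((add_le_add (ih (by omega)) hstep).trans_eq ?_)) <;> ring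

theorem log_div_floor_succ_sq_le_one {y : ℝ} (hy : 1 ≤ y) :
    Real.log (y / (⌊y⌋₊ + 1)) ^ 2 ≤ 1 := by
  have hfloor : (⌊y⌋₊ : ℝ) ≤ y := Nat.floor_le (by linarith)
  have hfloor_lt : y < ⌊y⌋₊ + 1 := Nat.lt_floor_add_one y
  have hy0 : 0 < y := by linarith
  have hupper : Real.log (y / (⌊y⌋₊ + 1)) ≤ 0 :=
    Real.log_nonpos (by positivity) ((div_le_one (by positivity)).mpr hfloor_lt.le)
  have hlower : -1 ≤ Real.log (y / (⌊y⌋₊ + 1)) := by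
    have hinv : (y / (⌊y⌋₊ + 1))⁻¹ ≤ 2 := by
      rw [inv_div, div_le_iff₀ hy0]
      linarith
    linarith [Real.one_sub_inv_le_log_of_pos (x := y / (⌊y⌋₊ + 1)) (by positivity)]
  nlinarith

theorem abs_sum_log_div_div_sub_le {y : ℝ} (hy : 1 ≤ y) :
    |∑ m ∈ Ioc 0 ⌊y⌋₊, Real.log (y / m) / m - Real.log y ^ 2 / 2| ≤ 2 * (1 + Real.log y) := by
  have hsum := abs_sum_Ioc_log_div_div_sub_le (le_refl ⌊y⌋₊)
  have hend := log_div_floor_succ_sq_le_one hy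
  have hlog := Real.log_nonneg hy
  have hmul : 0 ≤ (1 + Real.log y) * ((⌊y⌋₊ : ℝ) + 1)⁻¹ := by positivity
  have hend_nonneg := sq_nonneg (Real.log (y / (⌊y⌋₊ + 1)))
  rw [abs_le] at hsum ⊢
  constructor <;> linarith [hsum.1, hsum.2]

theorem abs_summatory_zeta_mul_zeta_mul_zeta_sub_le {y : ℝ} (hy : 1 ≤ y) :
    |summatory (ζ * ζ * ζ) y - 1 / 2 * (y * Real.log y ^ 2)| ≤ 3 * (y * (1 + Real.log y)) := by
  have hy0 : 0 ≤ y := by linarith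
  have hinner : |summatory (ζ * ζ * ζ) y - y * ∑ m ∈ Ioc 0 ⌊y⌋₊, Real.log (y / m) / m| ≤
      y * (1 + Real.log y) := by
    rw [mul_assoc, summatory_zeta_mul, mul_sum, ← sum_sub_distrib]
    refine (abs_sum_le_sum_abs _ _).trans (le_trans ?_
      (mul_le_mul_of_nonneg_left (sum_inv_le_one_add_log hy) hy0))
    rw [mul_sum]
    refine sum_le_sum fun m hm ↦ ?_
    rw [← div_eq_mul_inv, show y * (Real.log (y / m) / m) = y / m * Real.log (y / m) by ring]
    exact abs_summatory_zeta_mul_zeta_sub_le (one_le_div_of_mem_Ioc_floor hm)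
  have houter : |y * ∑ m ∈ Ioc 0 ⌊y⌋₊, Real.log (y / m) / m - 1 / 2 * (y * Real.log y ^ 2)| ≤
      2 * (y * (1 + Real.log y)) := by
    rw [show 1 / 2 * (y * Real.log y ^ 2) = y * (Real.log y ^ 2 / 2) by ring, ← mul_sub, abs_mul,
      abs_of_nonneg hy0]
    linarith [mul_le_mul_of_nonneg_left (abs_sum_log_div_div_sub_le hy) hy0]
  linarith [abs_sub_le (summatory (ζ * ζ * ζ) y) (y * ∑ m ∈ Ioc 0 ⌊y⌋₊, Real.log (y / m) / m)
    (1 / 2 * (y * Real.log y ^ 2))]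

end SummatoryFunctions

section ConvolutionWithSummableFunction

open ArithmeticFunction Finset
open scoped ArithmeticFunction.zeta

theorem abs_posLog_div_sq_sub_log_sq_le {y : ℝ} (hy : 1 ≤ y) {n : ℕ} (hn : n ≠ 0) :
    |Real.posLog (y / n) ^ 2 - Real.log y ^ 2| ≤ 2 * Real.log y * Real.log n := by
  have hlog_y := Real.log_nonneg hy
  have hlog_n := Real.log_natCast_nonneg n
  have hsub : Real.log (y / n) = Real.log y - Real.log n :=
    Real.log_div (by linarith) (by exact_mod_cast hn)
  have hpos : 0 ≤ Real.posLog (y / n) := Real.posLog_nonneg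
  have hle : Real.posLog (y / n) ≤ Real.log y := max_le hlog_y (by linarith)
  have hge : Real.log y - Real.log n ≤ Real.posLog (y / n) := hsub ▸ le_max_right _ _
  rw [abs_of_nonpos (by nlinarith)]
  nlinarith

theorem hasSum_mul_posLog_div_sq (a : ℕ → ℝ) {y : ℝ} (hy : 0 ≤ y) :
    HasSum (fun n : ℕ ↦ a n / n * Real.posLog (y / n) ^ 2)
      (∑ m ∈ Ioc 0 ⌊y⌋₊, a m / m * Real.log (y / m) ^ 2) := by
  have hlog (m : ℕ) (hm : m ∈ Ioc 0 ⌊y⌋₊) : Real.posLog (y / m) = Real.log (y / m) :=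
    max_eq_right (Real.log_nonneg (one_le_div_of_mem_Ioc_floor hm))
  rw [sum_congr rfl fun m hm ↦ by rw [← hlog m hm]]
  refine hasSum_sum_of_ne_finset_zero fun n hn ↦ ?_
  rcases Nat.eq_zero_or_pos n with rfl | hpos
  · simp
  have hlt : y < n := Nat.lt_of_floor_lt (not_le.mp fun h ↦ hn (mem_Ioc.mpr ⟨hpos, h⟩))
  have hle : |y / n| ≤ 1 := by
    rw [abs_of_nonneg (by positivity)]
    exact div_le_one_of_le₀ hlt.le n.cast_nonneg
  rw [(Real.posLog_eq_zero_iff _).mpr hle, zero_pow two_ne_zero, mul_zero]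

theorem abs_sum_mul_log_sq_sub_le {a : ℕ → ℝ}
    (ha : Summable fun n : ℕ ↦ |a n| * (1 + Real.log n) / n) {y : ℝ} (hy : 1 ≤ y) :
    |∑ m ∈ Ioc 0 ⌊y⌋₊, a m / m * Real.log (y / m) ^ 2 - (∑' n : ℕ, a n / n) * Real.log y ^ 2| ≤
      2 * Real.log y * ∑' n : ℕ, |a n| * (1 + Real.log n) / n := by
  have hlog_y := Real.log_nonneg hy
  have hdiff := (hasSum_mul_posLog_div_sq a (zero_le_one.trans hy)).sub
    ((summable_norm_div_of_summable_log ha).of_norm.hasSum.mul_right (Real.log y ^ 2))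
  rw [← hdiff.tsum_eq, ← Real.norm_eq_abs]
  refine tsum_of_norm_bounded (ha.hasSum.mul_left (2 * Real.log y)) fun n ↦ ?_
  rcases eq_or_ne n 0 with rfl | hn
  · simp
  rw [← mul_sub, Real.norm_eq_abs, abs_mul, abs_div, Nat.abs_cast]
  calc |a n| / n * |Real.posLog (y / n) ^ 2 - Real.log y ^ 2|
      ≤ |a n| / n * (2 * Real.log y * (1 + Real.log n)) := by
        gcongr
        refine (abs_posLog_div_sq_sub_log_sq_le hy hn).trans ?_
        gcongr
        linarith
    _ = 2 * Real.log y * (|a n| * (1 + Real.log n) / n) := by ring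

variable {g h : ArithmeticFunction ℝ} {κ B : ℝ}

theorem abs_summatory_mul_sub_sum_le
    (hg : Summable fun n : ℕ ↦ |g n| * (1 + Real.log n) / n)
    (hh : ∀ y, 1 ≤ y →
      |summatory h y - κ * (y * Real.log y ^ 2)| ≤ B * (y * (1 + Real.log y)))
    {y : ℝ} (hy : 1 ≤ y) :
    |summatory (g * h) y - κ * y * ∑ m ∈ Ioc 0 ⌊y⌋₊, g m / m * Real.log (y / m) ^ 2| ≤
      B * (y * (1 + Real.log y)) * ∑' n : ℕ, |g n| * (1 + Real.log n) / n := by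
  have hB : 0 ≤ B := by simpa using (abs_nonneg _).trans (hh 1 le_rfl)
  have hlog_y := Real.log_nonneg hy
  have hterm_nonneg (n : ℕ) : 0 ≤ |g n| * (1 + Real.log n) / n := by
    have := Real.log_natCast_nonneg n
    positivity
  rw [summatory_mul, mul_sum, ← sum_sub_distrib]
  refine (abs_sum_le_sum_abs _ _).trans (le_trans ?_ (mul_le_mul_of_nonneg_left
    (hg.sum_le_tsum (Ioc 0 ⌊y⌋₊) fun n _ ↦ hterm_nonneg n) (by positivity)))
  rw [mul_sum]
  refine sum_le_sum fun m hm ↦ ?_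
  have hlog_m := Real.log_natCast_nonneg m
  have hlog_le := log_div_le_log_of_mem_Ioc_floor hm
  calc |g m * summatory h (y / m) - κ * y * (g m / m * Real.log (y / m) ^ 2)|
      = |g m| * |summatory h (y / m) - κ * (y / m * Real.log (y / m) ^ 2)| := by
        rw [← abs_mul]
        congr 1
        ring
    _ ≤ |g m| * (B * (y / m * (1 + Real.log (y / m)))) := by
        gcongr
        exact hh _ (one_le_div_of_mem_Ioc_floor hm)
    _ ≤ |g m| * (B * (y / m * (1 + Real.log y))) := by gcongr
    _ = B * (y * (1 + Real.log y)) * (|g m| * 1 / m) := by ring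
    _ ≤ B * (y * (1 + Real.log y)) * (|g m| * (1 + Real.log m) / m) := by
        gcongr
        linarith

theorem abs_summatory_mul_sub_le
    (hg : Summable fun n : ℕ ↦ |g n| * (1 + Real.log n) / n)
    (hh : ∀ y, 1 ≤ y →
      |summatory h y - κ * (y * Real.log y ^ 2)| ≤ B * (y * (1 + Real.log y)))
    {y : ℝ} (hy : 1 ≤ y) :
    |summatory (g * h) y - κ * (∑' n : ℕ, g n / n) * (y * Real.log y ^ 2)| ≤
      (2 * |κ| + B) * (∑' n : ℕ, |g n| * (1 + Real.log n) / n) * (y * (1 + Real.log y)) := by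
  set T := ∑' n : ℕ, |g n| * (1 + Real.log n) / n
  set M := ∑ m ∈ Ioc 0 ⌊y⌋₊, g m / m * Real.log (y / m) ^ 2
  have hT0 : 0 ≤ T := tsum_nonneg fun n ↦ by
    have := Real.log_natCast_nonneg n
    positivity
  have hmain : |κ * y * M - κ * (∑' n : ℕ, g n / n) * (y * Real.log y ^ 2)| ≤
      2 * |κ| * T * (y * (1 + Real.log y)) := by
    calc |κ * y * M - κ * (∑' n : ℕ, g n / n) * (y * Real.log y ^ 2)|
        = |κ| * y * |M - (∑' n : ℕ, g n / n) * Real.log y ^ 2| := by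
          rw [← abs_of_nonneg (show 0 ≤ y by linarith), ← abs_mul, ← abs_mul,
            abs_of_nonneg (show 0 ≤ y by linarith)]
          congr 1
          ring
      _ ≤ |κ| * y * (2 * Real.log y * T) := by
          gcongr
          exact abs_sum_mul_log_sq_sub_le hg hy
      _ ≤ |κ| * y * (2 * (1 + Real.log y) * T) := by
          gcongr
          linarith
      _ = 2 * |κ| * T * (y * (1 + Real.log y)) := by ring
  linarith [abs_sub_le (summatory (g * h) y) (κ * y * M)
    (κ * (∑' n : ℕ, g n / n) * (y * Real.log y ^ 2)), abs_summatory_mul_sub_sum_le hg hh hy]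

theorem one_add_log_isBigO_log : (fun y : ℝ ↦ 1 + Real.log y) =O[atTop] Real.log :=
  Real.isLittleO_const_log_atTop.isBigO.add (isBigO_refl _ _)

theorem summatory_mul_sub_isBigO (hg : Summable fun n : ℕ ↦ |g n| * (1 + Real.log n) / n)
    (hh : ∀ y, 1 ≤ y →
      |summatory h y - κ * (y * Real.log y ^ 2)| ≤ B * (y * (1 + Real.log y))) :
    (fun y ↦ summatory (g * h) y - κ * (∑' n : ℕ, g n / n) * (y * Real.log y ^ 2))
      =O[atTop] fun y ↦ y * Real.log y := by
  refine (IsBigO.of_bound ((2 * |κ| + B) * ∑' n : ℕ, |g n| * (1 + Real.log n) / n) ?_).trans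
    ((isBigO_refl (fun y : ℝ ↦ y) _).mul one_add_log_isBigO_log)
  filter_upwards [eventually_ge_atTop 1] with y hy
  have hlog_y := Real.log_nonneg hy
  rw [Real.norm_eq_abs, Real.norm_of_nonneg (by positivity)]
  exact abs_summatory_mul_sub_le hg hh hy

theorem summatory_weightedTriples_zeta_sub_isBigO :
    (fun y ↦ summatory (weightedTriples ζ ζ ζ) y -
      1 / 2 * (∑' n : ℕ, correction ζ ζ ζ n / n) * (y * Real.log y ^ 2))
      =O[atTop] fun y ↦ y * Real.log y := by
  have hz := isBoundedCharacter_zeta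
  rw [← correction_mul_mul_mul hz hz hz]
  exact summatory_mul_sub_isBigO (summable_correction_log hz hz hz) fun y hy ↦
    abs_summatory_zeta_mul_zeta_mul_zeta_sub_le hy

end ConvolutionWithSummableFunction

section CharacterModuloFour

open ArithmeticFunction Finset
open scoped ArithmeticFunction.zeta

theorem abs_summatory_mul_mul_zeta_le {c : ArithmeticFunction ℝ} (hc : ∀ n, |c n| ≤ 1)
    (hsum : ∀ y, |summatory c y| ≤ 1) {y : ℝ} (hy : 1 ≤ y) :
    |summatory (c * c * ζ) y| ≤ y * (1 + Real.log y) := by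
  have hconv (m : ℕ) : |(c * (ζ : ArithmeticFunction ℝ)) m| ≤ (ζ * ζ : ArithmeticFunction ℝ) m := by
    rw [coe_mul_zeta_apply, coe_mul_zeta_apply]
    refine (abs_sum_le_sum_abs _ _).trans (sum_le_sum fun d hd ↦ ?_)
    rw [natCoe_apply, zeta_apply_ne (Nat.pos_of_mem_divisors hd).ne', Nat.cast_one]
    exact hc d
  rw [show c * c * (ζ : ArithmeticFunction ℝ) = c * ζ * c by ring, summatory_mul]
  calc |∑ m ∈ Ioc 0 ⌊y⌋₊, (c * (ζ : ArithmeticFunction ℝ)) m * summatory c (y / m)|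
      ≤ ∑ m ∈ Ioc 0 ⌊y⌋₊, |(c * (ζ : ArithmeticFunction ℝ)) m * summatory c (y / m)| :=
        abs_sum_le_sum_abs _ _
    _ ≤ summatory (ζ * ζ) y := by
        refine sum_le_sum fun m _ ↦ ?_
        rw [abs_mul]
        exact (mul_le_of_le_one_right (abs_nonneg _) (hsum _)).trans (hconv m)
    _ ≤ y * (1 + Real.log y) := by
        linarith [(abs_le.mp (abs_summatory_zeta_mul_zeta_sub_le hy)).2]

/-- The quadratic character modulo `4`, as a real arithmetic function. -/
noncomputable def chiFour : ArithmeticFunction ℝ := ⟨fun n ↦ ((ZMod.χ₄ n : ℤ) : ℝ), by simp⟩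

theorem chiFour_apply (n : ℕ) : chiFour n = ((ZMod.χ₄ n : ℤ) : ℝ) := rfl

theorem chiFour_eq_if_mod_four (n : ℕ) :
    chiFour n = if n % 2 = 0 then 0 else if n % 4 = 1 then 1 else -1 := by
  rw [chiFour_apply, ZMod.χ₄_nat_eq_if_mod_four]
  split_ifs <;> simp

theorem isBoundedCharacter_chiFour : IsBoundedCharacter chiFour where
  map_one := by simp [chiFour_apply]
  map_mul m n := by simp only [chiFour_apply, Nat.cast_mul, map_mul, Int.cast_mul]
  abs_le n := by
    rw [chiFour_eq_if_mod_four]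
    split_ifs <;> simp

theorem sum_Ioc_chiFour (N : ℕ) :
    ∑ n ∈ Ioc 0 N, chiFour n = if N % 4 = 1 ∨ N % 4 = 2 then 1 else 0 := by
  induction N with
  | zero => simp
  | succ N ih =>
    rw [sum_Ioc_succ_top N.zero_le, ih, chiFour_eq_if_mod_four]
    split_ifs <;> first | omega | norm_num

theorem abs_summatory_chiFour_le (y : ℝ) : |summatory chiFour y| ≤ 1 := by
  rw [summatory, sum_Ioc_chiFour]
  split_ifs <;> simp

theorem summatory_weightedTriples_chiFour_isBigO :
    summatory (weightedTriples chiFour chiFour ζ) =O[atTop] fun y ↦ y * Real.log y := by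
  have hχ := isBoundedCharacter_chiFour
  have hz := isBoundedCharacter_zeta
  rw [← correction_mul_mul_mul hχ hχ hz]
  simpa using summatory_mul_sub_isBigO (κ := 0) (B := 1) (summable_correction_log hχ hχ hz)
    fun y hy ↦ by simpa using abs_summatory_mul_mul_zeta_le hχ.abs_le abs_summatory_chiFour_le hy

end CharacterModuloFour

/-! ### Counting triples and fields -/

section CountingTriples

open ArithmeticFunction Finset
open scoped ArithmeticFunction.zeta

/-- The ordered triples `(u, v, w)` with `u v w ≤ N` odd and squarefree. -/
def orderedTriples (N : ℕ) : Finset (ℕ × ℕ × ℕ) :=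
  {p ∈ Ioc 0 N ×ˢ Ioc 0 N ×ˢ Ioc 0 N |
    p.1 * p.2.1 * p.2.2 ≤ N ∧ Odd (p.1 * p.2.1 * p.2.2) ∧ Squarefree (p.1 * p.2.1 * p.2.2)}

theorem mem_orderedTriples {N u v w : ℕ} : (u, v, w) ∈ orderedTriples N ↔
    u * v * w ≤ N ∧ Odd (u * v * w) ∧ Squarefree (u * v * w) := by
  simp only [orderedTriples, mem_filter, mem_product, mem_Ioc, and_iff_right_iff_imp]
  rintro ⟨hle, -, hsq⟩
  have mem_Ioc_of_dvd {d : ℕ} (hd : d ∣ u * v * w) : 0 < d ∧ d ≤ N :=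
    ⟨Nat.pos_of_dvd_of_pos hd (Nat.pos_of_ne_zero hsq.ne_zero),
      (Nat.le_of_dvd (Nat.pos_of_ne_zero hsq.ne_zero) hd).trans hle⟩
  exact ⟨mem_Ioc_of_dvd ⟨v * w, by ring⟩, mem_Ioc_of_dvd ⟨u * w, by ring⟩,
    mem_Ioc_of_dvd ⟨u * v, by ring⟩⟩

theorem sum_orderedTriples_mul_eq (f g h : ArithmeticFunction ℝ) {N n : ℕ} (hn : n ≤ N) :
    ∑ p ∈ orderedTriples N with p.1 * p.2.1 * p.2.2 = n, f p.1 * g p.2.1 * h p.2.2 =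
      weightedTriples f g h n := by
  rw [weightedTriples, pmul_apply, oddSquarefree_apply]
  split_ifs with hn_odd_sq
  · simp only [one_mul, mul_apply, sum_mul]
    rw [sum_sigma']
    refine sum_nbij' (fun p ↦ ⟨(p.1 * p.2.1, p.2.2), (p.1, p.2.1)⟩)
      (fun x ↦ (x.2.1, x.2.2, x.1.2)) ?_ ?_ (fun _ _ ↦ rfl) ?_ (fun _ _ ↦ rfl)
    · rintro ⟨u, v, w⟩ hp
      obtain ⟨-, rfl⟩ := mem_filter.mp hp
      exact mem_sigma.mpr ⟨Nat.mem_divisorsAntidiagonal.mpr ⟨rfl, hn_odd_sq.2.ne_zero⟩,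
        Nat.mem_divisorsAntidiagonal.mpr ⟨rfl, left_ne_zero_of_mul hn_odd_sq.2.ne_zero⟩⟩
    · rintro ⟨⟨d, w⟩, u, v⟩ hx
      simp only [mem_sigma, Nat.mem_divisorsAntidiagonal] at hx
      obtain ⟨⟨rfl, -⟩, rfl, -⟩ := hx
      exact mem_filter.mpr ⟨mem_orderedTriples.mpr ⟨hn, hn_odd_sq⟩, rfl⟩
    · rintro ⟨⟨d, w⟩, u, v⟩ hx
      simp only [mem_sigma, Nat.mem_divisorsAntidiagonal] at hx
      obtain ⟨-, rfl, -⟩ := hx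
      rfl
  · rw [zero_mul, filter_eq_empty_iff.mpr, sum_empty]
    rintro ⟨u, v, w⟩ hp rfl
    exact hn_odd_sq (mem_orderedTriples.mp hp).2

theorem sum_orderedTriples (f g h : ArithmeticFunction ℝ) (y : ℝ) :
    ∑ p ∈ orderedTriples ⌊y⌋₊, f p.1 * g p.2.1 * h p.2.2 =
      summatory (weightedTriples f g h) y := by
  rw [summatory, ← sum_fiberwise_of_maps_to (g := fun p ↦ p.1 * p.2.1 * p.2.2)]
  · exact sum_congr rfl fun n hn ↦ sum_orderedTriples_mul_eq f g h (mem_Ioc.mp hn).2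
  · rintro ⟨u, v, w⟩ hp
    obtain ⟨hle, -, hsq⟩ := mem_orderedTriples.mp hp
    exact mem_Ioc.mpr ⟨Nat.pos_of_ne_zero hsq.ne_zero, hle⟩

theorem zeta_mul_zeta_mul_zeta_of_mem_orderedTriples {N : ℕ} {p : ℕ × ℕ × ℕ}
    (hp : p ∈ orderedTriples N) :
    (ζ : ArithmeticFunction ℝ) p.1 * (ζ : ArithmeticFunction ℝ) p.2.1 *
      (ζ : ArithmeticFunction ℝ) p.2.2 = 1 := by
  have hne := (mem_orderedTriples.mp hp).2.2.ne_zero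
  obtain ⟨huv, hw⟩ := mul_ne_zero_iff.mp hne
  obtain ⟨hu, hv⟩ := mul_ne_zero_iff.mp huv
  simp [natCoe_apply, hu, hv, hw]

theorem card_orderedTriples (y : ℝ) :
    (#(orderedTriples ⌊y⌋₊) : ℝ) = summatory (weightedTriples ζ ζ ζ) y := by
  rw [← sum_orderedTriples,
    sum_congr rfl fun p hp ↦ zeta_mul_zeta_mul_zeta_of_mem_orderedTriples hp, sum_const,
    nsmul_one]

theorem four_mul_ite_agreeModFour {u v w : ℕ} (hodd : Odd (u * v * w)) :
    4 * (if AgreeModFour (u, v, w) then (1 : ℝ) else 0) =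
      1 + chiFour u * chiFour v + chiFour u * chiFour w + chiFour v * chiFour w := by
  obtain ⟨huv, hw⟩ := Nat.odd_mul.mp hodd
  obtain ⟨hu, hv⟩ := Nat.odd_mul.mp huv
  have chiFour_of_odd {n : ℕ} (hn : Odd n) :
      n % 4 = 1 ∧ chiFour n = 1 ∨ n % 4 = 3 ∧ chiFour n = -1 := by
    have hn2 := Nat.odd_iff.mp hn
    rw [chiFour_eq_if_mod_four, if_neg (by omega)]
    split_ifs with hn4
    · exact Or.inl ⟨hn4, rfl⟩
    · exact Or.inr ⟨by omega, rfl⟩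
  obtain ⟨hu4, hχu⟩ | ⟨hu4, hχu⟩ := chiFour_of_odd hu <;>
    obtain ⟨hv4, hχv⟩ | ⟨hv4, hχv⟩ := chiFour_of_odd hv <;>
    obtain ⟨hw4, hχw⟩ | ⟨hw4, hχw⟩ := chiFour_of_odd hw <;>
    simp only [AgreeModFour, hu4, hv4, hw4, hχu, hχv, hχw] <;> norm_num

theorem four_mul_card_agreeModFour (y : ℝ) :
    4 * (#{p ∈ orderedTriples ⌊y⌋₊ | AgreeModFour p} : ℝ) =
      summatory (weightedTriples ζ ζ ζ) y +
        3 * summatory (weightedTriples chiFour chiFour ζ) y := by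
  have hpoint (p : ℕ × ℕ × ℕ) (hp : p ∈ orderedTriples ⌊y⌋₊) :
      4 * (if AgreeModFour p then (1 : ℝ) else 0) =
        1 + chiFour p.1 * chiFour p.2.1 * (ζ : ArithmeticFunction ℝ) p.2.2 +
          chiFour p.1 * (ζ : ArithmeticFunction ℝ) p.2.1 * chiFour p.2.2 +
          (ζ : ArithmeticFunction ℝ) p.1 * chiFour p.2.1 * chiFour p.2.2 := by
    obtain ⟨-, hodd, hsq⟩ := mem_orderedTriples.mp hp
    obtain ⟨huv, hw⟩ := mul_ne_zero_iff.mp hsq.ne_zero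
    obtain ⟨hu, hv⟩ := mul_ne_zero_iff.mp huv
    simp [four_mul_ite_agreeModFour hodd, natCoe_apply, hu, hv, hw]
  have hswap_right : weightedTriples chiFour ζ chiFour = weightedTriples chiFour chiFour ζ := by
    rw [weightedTriples, weightedTriples, mul_right_comm]
  have hrotate : weightedTriples ζ chiFour chiFour = weightedTriples chiFour chiFour ζ := by
    rw [weightedTriples, weightedTriples, mul_assoc, mul_comm]
  rw [card_filter, Nat.cast_sum, mul_sum]
  simp only [Nat.cast_ite, Nat.cast_one, Nat.cast_zero]
  rw [sum_congr rfl hpoint, sum_add_distrib, sum_add_distrib, sum_add_distrib, sum_const,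
    nsmul_one, card_orderedTriples, sum_orderedTriples, sum_orderedTriples, sum_orderedTriples,
    hswap_right, hrotate]
  ring

theorem sum_swap_left {M : Type*} [AddCommMonoid M] {Q : Finset (ℕ × ℕ × ℕ)}
    (hQ : ∀ {u v w}, (u, v, w) ∈ Q → (v, u, w) ∈ Q) (F : ℕ → ℕ → ℕ → M) :
    ∑ p ∈ Q, F p.2.1 p.1 p.2.2 = ∑ p ∈ Q, F p.1 p.2.1 p.2.2 :=
  sum_nbij' (fun p ↦ (p.2.1, p.1, p.2.2)) (fun p ↦ (p.2.1, p.1, p.2.2)) (fun _ h ↦ hQ h)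
    (fun _ h ↦ hQ h) (fun _ _ ↦ rfl) (fun _ _ ↦ rfl) (fun _ _ ↦ rfl)

theorem sum_swap_right {M : Type*} [AddCommMonoid M] {Q : Finset (ℕ × ℕ × ℕ)}
    (hQ : ∀ {u v w}, (u, v, w) ∈ Q → (u, w, v) ∈ Q) (F : ℕ → ℕ → ℕ → M) :
    ∑ p ∈ Q, F p.1 p.2.2 p.2.1 = ∑ p ∈ Q, F p.1 p.2.1 p.2.2 :=
  sum_nbij' (fun p ↦ (p.1, p.2.2, p.2.1)) (fun p ↦ (p.1, p.2.2, p.2.1)) (fun _ h ↦ hQ h)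
    (fun _ h ↦ hQ h) (fun _ _ ↦ rfl) (fun _ _ ↦ rfl) (fun _ _ ↦ rfl)

theorem six_mul_card_sorted {Q : Finset (ℕ × ℕ × ℕ)}
    (hleft : ∀ {u v w}, (u, v, w) ∈ Q → (v, u, w) ∈ Q)
    (hright : ∀ {u v w}, (u, v, w) ∈ Q → (u, w, v) ∈ Q) :
    6 * #{p ∈ Q | p.1 < p.2.1 ∧ p.2.1 < p.2.2} =
      #{p ∈ Q | p.1 ≠ p.2.1 ∧ p.1 ≠ p.2.2 ∧ p.2.1 ≠ p.2.2} := by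
  let sorted (u v w : ℕ) : ℕ := if u < v ∧ v < w then 1 else 0
  have hpoint (u v w : ℕ) : (if u ≠ v ∧ u ≠ w ∧ v ≠ w then 1 else 0) =
      sorted u v w + sorted v u w + sorted u w v + sorted v w u + sorted w u v + sorted w v u := by
    simp only [sorted]
    split_ifs <;> omega
  have hvuw := sum_swap_left hleft sorted
  have huwv := sum_swap_right hright sorted
  have hvwu := (sum_swap_left hleft fun u v w ↦ sorted u w v).trans huwv
  have hwuv := (sum_swap_right hright fun u v w ↦ sorted v u w).trans hvuw
  have hwvu := (sum_swap_right hright fun u v w ↦ sorted v w u).trans hvwu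
  rw [card_filter, card_filter]
  simp only [hpoint, sum_add_distrib]
  change 6 * ∑ p ∈ Q, sorted p.1 p.2.1 p.2.2 = _
  omega

end CountingTriples

section CountingFields

open ArithmeticFunction Finset
open scoped ArithmeticFunction.zeta

theorem tripleDiscr_le_iff_of_agreeModFour {X : ℝ} {u v w : ℕ} (hne : u * v * w ≠ 0)
    (h : AgreeModFour (u, v, w)) : (tripleDiscr (u, v, w) : ℝ) ≤ X ↔ u * v * w ≤ ⌊√X⌋₊ := by
  have hpos : (0 : ℝ) < (u * v * w : ℕ) := by exact_mod_cast Nat.pos_of_ne_zero hne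
  rw [Nat.le_floor_iff' hne, Real.le_sqrt' hpos, tripleDiscr, if_pos h, one_mul, Nat.cast_pow]

theorem tripleDiscr_le_iff_of_not_agreeModFour {X : ℝ} {u v w : ℕ} (hne : u * v * w ≠ 0)
    (h : ¬AgreeModFour (u, v, w)) :
    (tripleDiscr (u, v, w) : ℝ) ≤ X ↔ u * v * w ≤ ⌊√X / 4⌋₊ := by
  have hpos : (0 : ℝ) < (u * v * w : ℕ) := by exact_mod_cast Nat.pos_of_ne_zero hne
  rw [Nat.le_floor_iff' hne, le_div_iff₀ four_pos, Real.le_sqrt' (by positivity), tripleDiscr,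
    if_neg h]
  push_cast
  ring_nf

/-- The ordered triples, not necessarily with distinct entries, whose discriminant is at most
`X`. -/
noncomputable def boundedTriples (X : ℝ) : Finset (ℕ × ℕ × ℕ) :=
  {p ∈ orderedTriples ⌊√X⌋₊ | (tripleDiscr p : ℝ) ≤ X}

theorem mem_boundedTriples {X : ℝ} {u v w : ℕ} : (u, v, w) ∈ boundedTriples X ↔
    Odd (u * v * w) ∧ Squarefree (u * v * w) ∧ (tripleDiscr (u, v, w) : ℝ) ≤ X := by
  rw [boundedTriples, mem_filter, mem_orderedTriples]
  refine ⟨fun ⟨⟨_, hodd, hsq⟩, hX⟩ ↦ ⟨hodd, hsq, hX⟩, fun ⟨hodd, hsq, hX⟩ ↦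
    ⟨⟨?_, hodd, hsq⟩, hX⟩⟩
  by_cases h : AgreeModFour (u, v, w)
  · exact (tripleDiscr_le_iff_of_agreeModFour hsq.ne_zero h).mp hX
  · refine ((tripleDiscr_le_iff_of_not_agreeModFour hsq.ne_zero h).mp hX).trans
      (Nat.floor_mono ?_)
    linarith [Real.sqrt_nonneg X]

theorem card_boundedTriples (X : ℝ) :
    #(boundedTriples X) = #{p ∈ orderedTriples ⌊√X⌋₊ | AgreeModFour p} +
      #{p ∈ orderedTriples ⌊√X / 4⌋₊ | ¬AgreeModFour p} := by
  rw [← card_filter_add_card_filter_not AgreeModFour]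
  congr 2
  all_goals
    ext ⟨u, v, w⟩
    simp only [mem_filter, mem_boundedTriples, mem_orderedTriples]
    by_cases hsq : Squarefree (u * v * w)
    swap; · tauto
    by_cases h : AgreeModFour (u, v, w)
    · rw [tripleDiscr_le_iff_of_agreeModFour hsq.ne_zero h]
      tauto
    · rw [tripleDiscr_le_iff_of_not_agreeModFour hsq.ne_zero h]
      tauto

theorem four_mul_card_boundedTriples (X : ℝ) :
    4 * (#(boundedTriples X) : ℝ) =
      summatory (weightedTriples ζ ζ ζ) √X + 3 * summatory (weightedTriples ζ ζ ζ) (√X / 4) +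
        3 * summatory (weightedTriples chiFour chiFour ζ) √X -
        3 * summatory (weightedTriples chiFour chiFour ζ) (√X / 4) := by
  have hcompl : (#{p ∈ orderedTriples ⌊√X / 4⌋₊ | AgreeModFour p} : ℝ) +
      #{p ∈ orderedTriples ⌊√X / 4⌋₊ | ¬AgreeModFour p} = #(orderedTriples ⌊√X / 4⌋₊) := by
    exact_mod_cast card_filter_add_card_filter_not AgreeModFour
  rw [card_boundedTriples, Nat.cast_add]
  linarith [four_mul_card_agreeModFour √X, four_mul_card_agreeModFour (√X / 4),
    card_orderedTriples (√X / 4)]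

theorem boundedTriples_swap_left {X : ℝ} {u v w : ℕ} (h : (u, v, w) ∈ boundedTriples X) :
    (v, u, w) ∈ boundedTriples X := by
  have hagree : AgreeModFour (v, u, w) ↔ AgreeModFour (u, v, w) := by
    simp only [AgreeModFour]
    omega
  simp only [mem_boundedTriples, tripleDiscr, hagree] at h ⊢
  rwa [mul_comm v u]

theorem boundedTriples_swap_right {X : ℝ} {u v w : ℕ} (h : (u, v, w) ∈ boundedTriples X) :
    (u, w, v) ∈ boundedTriples X := by
  have hagree : AgreeModFour (u, w, v) ↔ AgreeModFour (u, v, w) := by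
    simp only [AgreeModFour]
    omega
  simp only [mem_boundedTriples, tripleDiscr, hagree] at h ⊢
  rwa [mul_right_comm]

/-- Two equal entries of a triple with squarefree product must both be `1`. -/
theorem filter_not_distinct_boundedTriples_subset (X : ℝ) :
    {p ∈ boundedTriples X | ¬(p.1 ≠ p.2.1 ∧ p.1 ≠ p.2.2 ∧ p.2.1 ≠ p.2.2)} ⊆
      (Ioc 0 ⌊√X⌋₊).image (fun n ↦ (1, 1, n)) ∪ (Ioc 0 ⌊√X⌋₊).image (fun n ↦ (1, n, 1)) ∪
        (Ioc 0 ⌊√X⌋₊).image (fun n ↦ (n, 1, 1)) := by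
  rintro ⟨u, v, w⟩ hp
  simp only [boundedTriples, orderedTriples, mem_filter, mem_product] at hp
  obtain ⟨⟨⟨⟨hu, hv, hw⟩, -, -, hsq⟩, -⟩, hne⟩ := hp
  have eq_one {n m : ℕ} (hnm : u * v * w = n * n * m) : n = 1 :=
    Nat.isUnit_iff.mp (hsq n ⟨m, hnm⟩)
  simp only [mem_union, mem_image, Prod.mk.injEq]
  obtain rfl | rfl | rfl : u = v ∨ u = w ∨ v = w := by tauto
  · obtain rfl := eq_one (n := u) (m := w) rfl
    exact Or.inl (Or.inl ⟨w, hw, rfl, rfl, rfl⟩)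
  · obtain rfl := eq_one (n := u) (m := v) (by ring)
    exact Or.inl (Or.inr ⟨v, hv, rfl, rfl, rfl⟩)
  · obtain rfl := eq_one (n := v) (m := u) (by ring)
    exact Or.inr ⟨u, hu, rfl, rfl, rfl⟩

theorem card_not_distinct_boundedTriples_le (X : ℝ) :
    #{p ∈ boundedTriples X | ¬(p.1 ≠ p.2.1 ∧ p.1 ≠ p.2.2 ∧ p.2.1 ≠ p.2.2)} ≤ 3 * ⌊√X⌋₊ := by
  have card_image_Ioc_le (f : ℕ → ℕ × ℕ × ℕ) : #((Ioc 0 ⌊√X⌋₊).image f) ≤ ⌊√X⌋₊ :=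
    card_image_le.trans_eq (by simp)
  calc #{p ∈ boundedTriples X | ¬(p.1 ≠ p.2.1 ∧ p.1 ≠ p.2.2 ∧ p.2.1 ≠ p.2.2)}
      ≤ ⌊√X⌋₊ + ⌊√X⌋₊ + ⌊√X⌋₊ :=
        (card_le_card (filter_not_distinct_boundedTriples_subset X)).trans <|
          (card_union_le _ _).trans <| add_le_add
            ((card_union_le _ _).trans (add_le_add (card_image_Ioc_le _) (card_image_Ioc_le _)))
            (card_image_Ioc_le _)
    _ = 3 * ⌊√X⌋₊ := by ring

theorem sep_sortedTriples_eq_coe_filter (X : ℝ) :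
    {p ∈ sortedTriples | (tripleDiscr p : ℝ) ≤ X} =
      ({p ∈ boundedTriples X | p.1 < p.2.1 ∧ p.2.1 < p.2.2} : Finset (ℕ × ℕ × ℕ)) := by
  ext ⟨u, v, w⟩
  rw [mem_coe, mem_filter, mem_boundedTriples]
  simp only [sortedTriples, Set.mem_ofPred_eq]
  tauto

theorem finite_oddRealBiquadraticFieldsUpTo (X : ℝ) : (oddRealBiquadraticFieldsUpTo X).Finite := by
  rw [oddRealBiquadraticFieldsUpTo_eq_image, sep_sortedTriples_eq_coe_filter]
  exact (finite_toSet _).image _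

theorem ncard_oddRealBiquadraticFieldsUpTo (X : ℝ) : (oddRealBiquadraticFieldsUpTo X).ncard =
    #{p ∈ boundedTriples X | p.1 < p.2.1 ∧ p.2.1 < p.2.2} := by
  rw [oddRealBiquadraticFieldsUpTo_eq_image, Set.InjOn.ncard_image
    (biquadraticField_injOn.mono (Set.sep_subset _ _)), sep_sortedTriples_eq_coe_filter,
    Set.ncard_coe_finset]

theorem abs_six_mul_ncard_sub_card_boundedTriples_le (X : ℝ) :
    |6 * ((oddRealBiquadraticFieldsUpTo X).ncard : ℝ) - #(boundedTriples X)| ≤ 3 * √X := by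
  have hsplit : (6 : ℝ) * (oddRealBiquadraticFieldsUpTo X).ncard +
      #{p ∈ boundedTriples X | ¬(p.1 ≠ p.2.1 ∧ p.1 ≠ p.2.2 ∧ p.2.1 ≠ p.2.2)} =
      #(boundedTriples X) := by
    rw [ncard_oddRealBiquadraticFieldsUpTo]
    exact_mod_cast (six_mul_card_sorted (boundedTriples_swap_left (X := X))
      boundedTriples_swap_right) ▸ card_filter_add_card_filter_not _
  rw [← hsplit, sub_add_cancel_left, abs_neg, Nat.abs_cast]
  calc (#{p ∈ boundedTriples X | ¬(p.1 ≠ p.2.1 ∧ p.1 ≠ p.2.2 ∧ p.2.1 ≠ p.2.2)} : ℝ)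
      ≤ 3 * ⌊√X⌋₊ := by exact_mod_cast card_not_distinct_boundedTriples_le X
    _ ≤ 3 * √X := by
      gcongr
      exact Nat.floor_le (Real.sqrt_nonneg X)

end CountingFields

section Asymptotics

open scoped ArithmeticFunction.zeta

theorem log_div_const_eventuallyEq {c : ℝ} (hc : c ≠ 0) :
    (fun y ↦ Real.log (y / c)) =ᶠ[atTop] fun y ↦ Real.log y - Real.log c := by
  filter_upwards [eventually_ne_atTop 0] with y hy using Real.log_div hy hc

theorem log_div_const_isBigO_log {c : ℝ} (hc : c ≠ 0) :
    (fun y ↦ Real.log (y / c)) =O[atTop] Real.log :=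
  (log_div_const_eventuallyEq hc).trans_isBigO
    ((isBigO_refl _ _).sub Real.isLittleO_const_log_atTop.isBigO)

theorem log_div_const_sq_sub_isBigO_log {c : ℝ} (hc : c ≠ 0) :
    (fun y ↦ Real.log (y / c) ^ 2 - Real.log y ^ 2) =O[atTop] Real.log := by
  have hfactor : (fun y ↦ Real.log (y / c) ^ 2 - Real.log y ^ 2) =ᶠ[atTop]
      fun y ↦ -Real.log c * (Real.log (y / c) + Real.log y) := by
    filter_upwards [log_div_const_eventuallyEq hc] with y hy
    rw [hy]
    ring
  exact hfactor.trans_isBigO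
    (((log_div_const_isBigO_log hc).add (isBigO_refl _ _)).const_mul_left _)

theorem div_const_mul_log_div_const_isBigO {c : ℝ} (hc : c ≠ 0) :
    (fun y ↦ y / c * Real.log (y / c)) =O[atTop] fun y ↦ y * Real.log y := by
  simp only [div_eq_inv_mul _ c, mul_assoc]
  exact ((isBigO_refl (fun y : ℝ ↦ y) _).mul
    (by simpa only [div_eq_inv_mul] using log_div_const_isBigO_log hc)).const_mul_left _

theorem summatory_weightedTriples_zeta_div_sub_isBigO {c : ℝ} (hc : 0 < c) :
    (fun y ↦ summatory (weightedTriples ζ ζ ζ) (y / c) -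
      1 / (2 * c) * (∑' n : ℕ, correction ζ ζ ζ n / n) * (y * Real.log y ^ 2))
      =O[atTop] fun y ↦ y * Real.log y := by
  have hscaled := (summatory_weightedTriples_zeta_sub_isBigO.comp_tendsto
    (tendsto_id.atTop_div_const hc)).trans (div_const_mul_log_div_const_isBigO hc.ne')
  have hlog := ((isBigO_refl (fun y : ℝ ↦ y) atTop).mul
    (log_div_const_sq_sub_isBigO_log hc.ne')).const_mul_left
      (1 / (2 * c) * ∑' n : ℕ, correction ζ ζ ζ n / n)
  refine (hscaled.add hlog).congr_left fun y ↦ ?_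
  simp only [Function.comp_apply, id_eq]
  ring

theorem summatory_weightedTriples_chiFour_div_isBigO {c : ℝ} (hc : 0 < c) :
    (fun y ↦ summatory (weightedTriples chiFour chiFour ζ) (y / c))
      =O[atTop] fun y ↦ y * Real.log y :=
  (summatory_weightedTriples_chiFour_isBigO.comp_tendsto
    (tendsto_id.atTop_div_const hc)).trans (div_const_mul_log_div_const_isBigO hc.ne')

theorem sqrt_mul_log_sqrt_isBigO :
    (fun X ↦ √X * Real.log √X) =O[atTop] fun X ↦ √X * Real.log X := by
  refine IsBigO.of_bound 1 ?_
  filter_upwards [eventually_ge_atTop 1] with X hX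
  have hlog := Real.log_nonneg hX
  rw [Real.log_sqrt (by linarith), Real.norm_of_nonneg (by positivity),
    Real.norm_of_nonneg (by positivity)]
  nlinarith [mul_nonneg (Real.sqrt_nonneg X) hlog]

theorem card_boundedTriples_sub_isBigO :
    (fun X ↦ ((boundedTriples X).card : ℝ) -
      7 / 128 * (∑' n : ℕ, correction ζ ζ ζ n / n) * (√X * Real.log X ^ 2))
      =O[atTop] fun X ↦ √X * Real.log X := by
  have hζ := summatory_weightedTriples_zeta_sub_isBigO
  have hζ_div := summatory_weightedTriples_zeta_div_sub_isBigO four_pos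
  have hχ := summatory_weightedTriples_chiFour_isBigO
  have hχ_div := summatory_weightedTriples_chiFour_div_isBigO four_pos
  have hcomb := (((hζ.add (hζ_div.const_mul_left 3)).add (hχ.const_mul_left 3)).sub
    (hχ_div.const_mul_left 3)).const_mul_left (1 / 4)
  refine .trans (.congr' (hcomb.comp_tendsto Real.tendsto_sqrt_atTop) ?_ .rfl)
    sqrt_mul_log_sqrt_isBigO
  filter_upwards [eventually_ge_atTop 0] with X hX
  simp only [Function.comp_apply, Real.log_sqrt hX]
  linarith [four_mul_card_boundedTriples X]

theorem ncard_oddRealBiquadraticFieldsUpTo_sub_isBigO :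
    (fun X ↦ ((oddRealBiquadraticFieldsUpTo X).ncard : ℝ) -
      7 / 768 * (∑' n : ℕ, correction ζ ζ ζ n / n) * (√X * Real.log X ^ 2))
      =O[atTop] fun X ↦ √X * Real.log X := by
  have hdegenerate : (fun X ↦ 6 * ((oddRealBiquadraticFieldsUpTo X).ncard : ℝ) -
      (boundedTriples X).card) =O[atTop] fun X ↦ √X * Real.log X := by
    have hsqrt : (fun X ↦ √X) =O[atTop] fun X ↦ √X * Real.log X := by
      simpa using (isBigO_refl (fun X ↦ √X) atTop).mul
        (Real.isLittleO_const_log_atTop (c := 1)).isBigO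
    refine (IsBigO.of_bound 3 (Eventually.of_forall fun X ↦ ?_)).trans hsqrt
    rw [Real.norm_eq_abs, Real.norm_of_nonneg (Real.sqrt_nonneg X)]
    exact abs_six_mul_ncard_sub_card_boundedTriples_le X
  refine ((hdegenerate.add card_boundedTriples_sub_isBigO).const_mul_left (1 / 6)).congr_left
    fun X ↦ ?_
  ring

end Asymptotics

theorem mainTheorem10 :
    (∀ X : ℝ, (oddRealBiquadraticFieldsUpTo X).Finite) ∧
    Multipliable biquadraticEulerFactor ∧
    (fun X : ℝ => ((oddRealBiquadraticFieldsUpTo X).ncard : ℝ) -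
        7 / 1920 * Real.sqrt X * (Real.log X) ^ 2 * ∏' p : Nat.Primes, biquadraticEulerFactor p)
      =O[atTop] (fun X : ℝ => Real.sqrt X * Real.log X) := by
  refine ⟨finite_oddRealBiquadraticFieldsUpTo, hasProd_biquadraticEulerFactor.multipliable, ?_⟩
  rw [hasProd_biquadraticEulerFactor.tprod_eq]
  refine ncard_oddRealBiquadraticFieldsUpTo_sub_isBigO.congr_left fun X ↦ ?_
  ring
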